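/- Call a finite set of integers $v_0<v_1<\dots<v_m$ a \emph{tile}, and call the multiset $\{v_i-v_{i-1}\}_{i=1}^{m}$ its \emph{gap set}. Write $\{d_1^{(k_1)},\dots,d_n^{(k_n)}\}$ for the multiset in which each $d_i$ is taken $k_i$ times. A gap set $T$ \emph{tiles an interval} of $\mathbb{Z}$ if some nonempty finite interval $\{a,a+1,\dots,b\}\subset\mathbb{Z}$ is a union of pairwise disjoint tiles, each with gap set $T$ (the order of the gaps may differ from tile to tile, and it is not required that every order occurs). There exist functions $g_i$, $i\ge 3$, of $2i-1$ arguments such that the following holds. Let $s\ge 2$ and $p\ge 1$ be integers, and let $d_1,\dots,d_{s+p}$ and $k_1,\dots,k_{s+p}$ be positive integers such that $$\sum_{i=3}^{s}k_i+1\le k_1,\qquad \sum_{i=s+1}^{s+p-1}k_i+1\le k_{s+p},\qquad d_2\ge d_1(k_1+k_2+1)^2,$$ and $$d_i\ge g_i(d_1,\dots,d_{i-1},k_1,\dots,k_i)\qquad\text{for each } i=3,\dots,s+p.$$ Then the gap set $\{d_1^{(k_1)},d_2^{(k_2)},\dots,d_{s+p}^{(k_{s+p})}\}$ tiles an interval of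 $\mathbb{Z}$. -/

import Mathlib

/-- The gap set of the increasing sequence `v 0 < v 1 < ⋯ < v m`: the multiset of the differences
between consecutive terms, `v (i + 1) - v i` for `0 ≤ i < m`. -/
def gapSet {m : ℕ} (v : Fin (m + 1) → ℤ) : Multiset ℤ :=
  (Finset.univ : Finset (Fin m)).val.map fun i => v i.succ - v i.castSucc

/-- `A` is a tile with gap set `T`: a finite set of integers whose points, listed in increasing
order, have `T` as the multiset of consecutive differences. -/
def IsTileWithGapSet (T : Multiset ℤ) (A : Set ℤ) : Prop :=
  ∃ (m : ℕ) (v : Fin (m + 1) → ℤ), StrictMono v ∧ Set.range v = A ∧ gapSet v = T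

/-- The gap set `T` tiles the set `S`: `S` is a disjoint union of tiles with gap set `T`. The gaps
may come in a different order in different tiles. -/
def GapSetTiles (T : Multiset ℤ) (S : Set ℤ) : Prop :=
  ∃ F : Set (Set ℤ), (∀ A ∈ F, IsTileWithGapSet T A) ∧ F.PairwiseDisjoint id ∧ ⋃₀ F = S

/-- The gap set `T` tiles some nonempty finite interval of integers. -/
def GapSetTilesInterval (T : Multiset ℤ) : Prop :=
  ∃ a b : ℤ, a ≤ b ∧ GapSetTiles T (Set.Icc a b)

/-- The multiset `{d 1 ^ (k 1), …, d n ^ (k n)}` in which `d i` is taken `k i` times. -/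
def gapMultiset (n : ℕ) (d k : ℕ → ℕ) : Multiset ℤ :=
  ∑ i ∈ Finset.Icc 1 n, Multiset.replicate (k i) (d i : ℤ)

/-!
Points `u x + v z`, for sequences `u` and `v` whose gaps run periodically through `T` and `V`,
behave like the cells `(x, z)` of a lattice: along a path with `card T` steps to the right and `card
V` steps upwards one meets exactly the gaps `T + V`. Tilings by tiles therefore arise from
partitions of lattice regions into paths. To be able to iterate this, not only tiles are used but
also *windows* with one point more, whose last gap repeats the first one (`IsWindow`).

The induction runs over the initial parts `T` of the list of gap lengths and shows that all long
intervals are disjoint unions of windows for `T` (`TilesLong`). Given this for `T` and a large new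
gap length `c`, the intervals of length `h c + j` and `h c + j + 1` consist of columns, that is, of
windows translated by `0, c, 2 c, …`; these two lengths are coprime, so all long intervals consist
of high columns (`SplitsTwice.tilesLong`). A high column is a rectangle, and it remains to cut
rectangles into paths. This is done by prescribing, for all `i`, the boundary between the paths
number `i - 1` and `i` through an increasing function `β` (`tiled_strip`, `tiled_wide_strip`). All
heights divisible by `2 (card T + m + 1)` can be reached with tiles alone, and for `m ≥ 2` copies of
`c` all large heights can be reached with windows (`exists_tiled_rect`).

For `m = 1` this argument does not cover the columns over the longer windows. Two gap lengths `c₁`,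
`c₂` are therefore added at once, with any multiplicities, which leads to boxes over plane
rectangles (`exists_good_rect`). A rectangle one of whose sides is suitably divisible is filled from
tiles for `T` and one of the two lengths. One rectangle with both sides in the residue class `1` is
obtained by letting a staircase run through it (`exists_good_block`): along the staircase the gaps
are `c₁` and `c₂` in a periodic order, so the box over it is a rectangle again, of a height that
windows can fill, and on either side of it each tile for `T` and `c₁` meets just one step of the
staircase (`exists_tiled_step`).

The induction starts from one gap length and from two gap lengths, where gaps `a ^ k, b` need an
explicit tiling of an interval by two rows (`tiled_Ico_pair`); then it proceeds by two lengths at a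
time (`tilesLong_gapMultiset`). At the end, if `D` is the last gap length, an interval of length `D`
is a disjoint union of windows for the other ones, and columns of a suitable height over these are
disjoint unions of tiles (`tiled_exact`).
-/

/-! ### Disjoint unions of sets of a given class -/

/-- `S` is a disjoint union of sets of the class `P`. -/
def Tiled {α : Type*} (P : Set α → Prop) (S : Set α) : Prop :=
  ∃ F : Set (Set α), (∀ A ∈ F, P A) ∧ F.PairwiseDisjoint id ∧ ⋃₀ F = S

namespace Tiled

variable {α β ι : Type*} {P : Set α → Prop} {Q : Set β → Prop} {S S' : Set α}

theorem empty : Tiled P (∅ : Set α) := ⟨∅, by simp, by simp, by simp⟩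

theorem of (h : P S) : Tiled P S :=
  ⟨{S}, by simpa using h, by simp, by simp⟩

/-- If the pieces of a tiling can be tiled by sets of another class, so can the whole set. -/
theorem bind {P' : Set α → Prop} (h : Tiled P S) (hP : ∀ A, P A → A ⊆ S → Tiled P' A) :
    Tiled P' S := by
  obtain ⟨F, hF, hd, rfl⟩ := h
  have h1 : ∀ A : F, Tiled P' A.1 := fun A => hP _ (hF _ A.2) (Set.subset_sUnion_of_mem A.2)
  choose G hG hGd hGu using h1
  have hsub : ∀ (A : F), ∀ B ∈ G A, B ⊆ A.1 := fun A B hB => by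
    rw [← hGu A]; exact Set.subset_sUnion_of_mem hB
  refine ⟨⋃ A, G A, ?_, ?_, ?_⟩
  · intro B hB
    obtain ⟨A, hA⟩ := Set.mem_iUnion.1 hB
    exact hG A B hA
  · intro B hB B' hB' hne
    obtain ⟨A, hA⟩ := Set.mem_iUnion.1 hB
    obtain ⟨A', hA'⟩ := Set.mem_iUnion.1 hB'
    by_cases h : A = A'
    · subst h; exact hGd A hA hA' hne
    · exact Set.disjoint_of_subset (hsub _ _ hA) (hsub _ _ hA')
        (hd A.2 A'.2 (fun h' => h (Subtype.ext h')))
  · rw [Set.sUnion_iUnion, Set.sUnion_eq_iUnion]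
    exact Set.iUnion_congr fun A => hGu A

theorem mono {P' : Set α → Prop} (h : Tiled P S) (hP : ∀ A, P A → P' A) : Tiled P' S :=
  h.bind fun A hA _ => of (hP A hA)

/-- A set is tiled as soon as all nonempty fibres of some labelling of it are. -/
theorem of_fibres (f : α → ι) (h : ∀ x ∈ S, Tiled P {y | y ∈ S ∧ f y = f x}) : Tiled P S := by
  have : Tiled (fun A => ∃ x ∈ S, A = {y | y ∈ S ∧ f y = f x}) S := by
    refine ⟨{A | ∃ x ∈ S, A = {y | y ∈ S ∧ f y = f x}}, fun A hA => hA, ?_, ?_⟩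
    · rintro _ ⟨x, hx, rfl⟩ _ ⟨x', hx', rfl⟩ hne
      refine Set.disjoint_left.2 fun y hy hy' => hne ?_
      have : f x = f x' := hy.2.symm.trans hy'.2
      simp [this]
    · ext y
      constructor
      · rintro ⟨_, ⟨x, hx, rfl⟩, hy⟩
        exact hy.1
      · intro hy
        exact ⟨_, ⟨y, hy, rfl⟩, hy, rfl⟩
  refine this.bind ?_
  rintro A ⟨x, hx, rfl⟩ _
  exact h x hx

theorem union (h : Tiled P S) (h' : Tiled P S') (hd : Disjoint S S') : Tiled P (S ∪ S') := by
  classical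
  refine of_fibres (fun x => x ∈ S) ?_
  rintro x (hx | hx)
  · convert h using 1
    ext y; simp only [Set.mem_ofPred_eq, Set.mem_union, hx, eq_iff_iff, iff_true]; tauto
  · have hx' : x ∉ S := fun h => Set.disjoint_left.1 hd h hx
    convert h' using 1
    ext y
    simp only [Set.mem_ofPred_eq, Set.mem_union, hx', eq_iff_iff, iff_false]
    exact ⟨fun h => h.1.resolve_left h.2,
      fun h => ⟨Or.inr h, fun h' => Set.disjoint_left.1 hd h' h⟩⟩

/-- Splitting a set by a predicate. -/
theorem split (p : α → Prop) (h : Tiled P {x | x ∈ S ∧ p x}) (h' : Tiled P {x | x ∈ S ∧ ¬ p x}) :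
    Tiled P S := by
  convert h.union h' (Set.disjoint_left.2 fun x hx hx' => hx'.2 hx.2) using 1
  ext x; simp only [Set.mem_union, Set.mem_ofPred_eq]; tauto

/-- Tilings can be pulled back along a map `π`, if the part of `R` over each piece is tiled. -/
theorem preimage (h : Tiled P S) (π : β → α) (R : Set β)
    (hP : ∀ A, P A → A ⊆ S → Tiled Q {x | π x ∈ A ∧ x ∈ R}) :
    Tiled Q {x | π x ∈ S ∧ x ∈ R} := by
  have : Tiled (fun B => ∃ A, P A ∧ A ⊆ S ∧ B = {x | π x ∈ A ∧ x ∈ R})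
      {x | π x ∈ S ∧ x ∈ R} := by
    obtain ⟨F, hF, hd, rfl⟩ := h
    refine ⟨(fun A => {x | π x ∈ A ∧ x ∈ R}) '' F, ?_, ?_, ?_⟩
    · rintro _ ⟨A, hA, rfl⟩
      exact ⟨A, hF A hA, Set.subset_sUnion_of_mem hA, rfl⟩
    · rintro _ ⟨A, hA, rfl⟩ _ ⟨A', hA', rfl⟩ hne
      have hAA : A ≠ A' := fun h => hne (by rw [h])
      exact Set.disjoint_left.2 fun x hx hx' => Set.disjoint_left.1 (hd hA hA' hAA) hx.1 hx'.1
    · ext x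
      simp only [Set.sUnion_image, Set.mem_iUnion, Set.mem_ofPred_eq, Set.mem_sUnion, exists_prop]
      constructor
      · rintro ⟨A, hA, hx, hR⟩; exact ⟨⟨A, hA, hx⟩, hR⟩
      · rintro ⟨⟨A, hA, hx⟩, hR⟩; exact ⟨A, hA, hx, hR⟩
  refine this.bind ?_
  rintro _ ⟨A, hA, hAS, rfl⟩ _
  exact hP A hA hAS

theorem image (h : Tiled P S) (E : α → β) (hE : Set.InjOn E S)
    (hP : ∀ A, P A → A ⊆ S → Q (E '' A)) : Tiled Q (E '' S) := by
  obtain ⟨F, hF, hd, rfl⟩ := h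
  refine ⟨(fun A => E '' A) '' F, ?_, ?_, ?_⟩
  · rintro _ ⟨A, hA, rfl⟩
    exact hP A (hF A hA) (Set.subset_sUnion_of_mem hA)
  · rintro _ ⟨A, hA, rfl⟩ _ ⟨A', hA', rfl⟩ hne
    have hAA : A ≠ A' := fun h => hne (by rw [h])
    refine Set.disjoint_left.2 ?_
    rintro _ ⟨x, hx, rfl⟩ ⟨y, hy, hxy⟩
    have := hE (Set.subset_sUnion_of_mem hA' hy) (Set.subset_sUnion_of_mem hA hx) hxy
    subst this
    exact Set.disjoint_left.1 (hd hA hA' hAA) hx hy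
  · ext x
    simp only [Set.sUnion_image, Set.mem_iUnion, Set.mem_image, Set.mem_sUnion, exists_prop]
    constructor
    · rintro ⟨A, hA, y, hy, rfl⟩; exact ⟨y, ⟨A, hA, hy⟩, rfl⟩
    · rintro ⟨y, ⟨A, hA, hy⟩, rfl⟩; exact ⟨A, hA, y, hy, rfl⟩

end Tiled

/-- Every integer `L ≥ n (n - 1)` is a sum of copies of `n` and `n + 1`. -/
theorem exists_eq_mul_add_mul_succ {n L : ℕ} (hn : 0 < n) (hL : n * (n - 1) ≤ L) :
    ∃ p q, L = p * n + q * (n + 1) := by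
  refine ⟨L / n - L % n, L % n, ?_⟩
  have h1 : L % n < n := Nat.mod_lt _ hn
  have h2 : n - 1 ≤ L / n := (Nat.le_div_iff_mul_le hn).2 (by rw [mul_comm]; exact hL)
  have h3 := Nat.div_add_mod L n
  obtain ⟨j, hj⟩ := Nat.exists_eq_add_of_le (show L % n ≤ L / n by omega)
  rw [hj] at h3 ⊢
  rw [Nat.add_sub_cancel_left]
  linarith [h3]

/-! ### Gap sequences and their windows -/

/-- `c` is an increasing sequence of integers whose gaps are periodic with period `card T`, the gaps
in one period being the members of `T`. -/
structure IsGapSeq (T : Multiset ℤ) (c : ℕ → ℤ) : Prop where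
  strictMono : StrictMono c
  periodic : ∀ i, c (i + Multiset.card T + 1) - c (i + Multiset.card T) = c (i + 1) - c i
  map_eq : (Multiset.range (Multiset.card T)).map (fun i => c (i + 1) - c i) = T

namespace IsGapSeq
variable {T : Multiset ℤ} {c : ℕ → ℤ}

theorem add_const (h : IsGapSeq T c) (a : ℤ) : IsGapSeq T (fun i => c i + a) where
  strictMono := fun i j hij => by simpa using h.strictMono hij
  periodic := fun i => by have := h.periodic i; linarith
  map_eq := by simpa using h.map_eq

theorem succ (h : IsGapSeq T c) : IsGapSeq T (fun i => c (i + 1)) where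
  strictMono := fun i j hij => h.strictMono (by omega)
  periodic := fun i => by
    have := h.periodic (i + 1)
    convert this using 3 <;> ring
  map_eq := by
    conv_rhs => rw [← h.map_eq]
    generalize ht : Multiset.card T = t
    have hper : c (t + 1) - c t = c (0 + 1) - c 0 := by
      have := h.periodic 0
      rwa [ht, zero_add] at this
    clear ht
    induction t with
    | zero => simp
    | succ t _ =>
      have h1 : Multiset.range (t + 1) = 0 ::ₘ (Multiset.range t).map (fun i => i + 1) := by
        rw [← Multiset.coe_range, ← Multiset.coe_range, List.range_succ_eq_map]
        simp
      conv_lhs => rw [Multiset.range_succ, Multiset.map_cons]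
      rw [h1, Multiset.map_cons, Multiset.map_map, hper]
      rfl

theorem shift (h : IsGapSeq T c) (j : ℕ) : IsGapSeq T (fun i => c (i + j)) := by
  induction j with
  | zero => simpa using h
  | succ j ih =>
    convert ih.succ using 2
    ring_nf

end IsGapSeq

theorem isGapSeq_replicate (m : ℕ) {a : ℤ} (ha : 0 < a) (b : ℤ) :
    IsGapSeq (Multiset.replicate m a) (fun i => a * i + b) where
  strictMono := fun i j hij => by
    have : (i : ℤ) < j := by exact_mod_cast hij
    simpa using mul_lt_mul_of_pos_left this ha
  periodic := fun i => by push_cast; ring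
  map_eq := by
    rw [Multiset.eq_replicate]
    refine ⟨by simp, fun b hb => ?_⟩
    rw [Multiset.mem_map] at hb
    obtain ⟨i, -, rfl⟩ := hb
    push_cast; ring

/-- Finitely many increasing terms extend to a gap sequence; if the next term repeats the first gap,
the extension agrees there as well. -/
theorem exists_isGapSeq (f : ℕ → ℤ) {t : ℕ} (ht : 0 < t) (hf : ∀ i < t, f i < f (i + 1)) :
    ∃ c, IsGapSeq ((Multiset.range t).map fun i => f (i + 1) - f i) c ∧ (∀ i ≤ t, c i = f i) ∧
      (f (t + 1) - f t = f 1 - f 0 → c (t + 1) = f (t + 1)) := by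
  set c : ℕ → ℤ := fun i => f (i % t) + (i / t : ℕ) * (f t - f 0) with hc
  have hgap : ∀ i, c (i + 1) - c i = f (i % t + 1) - f (i % t) := by
    intro i
    simp only [hc]
    have hi := Nat.div_add_mod i t
    have hlt := Nat.mod_lt i ht
    set q := i / t
    set r := i % t
    rcases Nat.lt_or_ge (r + 1) t with h | h
    · have h1 : (i + 1) % t = r + 1 := by
        rw [← hi, add_assoc, Nat.mul_add_mod, Nat.mod_eq_of_lt h]
      have h2 : (i + 1) / t = q := by
        rw [← hi, add_assoc, Nat.mul_add_div ht, Nat.div_eq_of_lt h, add_zero]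
      rw [h1, h2]; ring
    · have h0 : r + 1 = t := by omega
      have h1 : (i + 1) % t = 0 := by
        rw [← hi, add_assoc, h0]; simp
      have h2 : (i + 1) / t = q + 1 := by
        rw [← hi, add_assoc, h0, Nat.mul_add_div ht, Nat.div_self ht]
      rw [h1, h2, h0]; push_cast; ring
  have hle : ∀ i ≤ t, c i = f i := by
    intro i hi
    rcases hi.lt_or_eq with h | rfl
    · simp only [hc]; rw [Nat.mod_eq_of_lt h, Nat.div_eq_of_lt h]; simp
    · simp only [hc]; rw [Nat.div_self ht, Nat.mod_self]; simp
  refine ⟨c, ⟨strictMono_nat_of_lt_succ fun i => ?_, fun i => ?_, ?_⟩, hle, fun h => ?_⟩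
  · have := hf _ (Nat.mod_lt i ht)
    have := hgap i
    linarith
  · simp only [Multiset.card_map, Multiset.card_range]
    rw [hgap, hgap]; simp
  · simp only [Multiset.card_map, Multiset.card_range]
    refine Multiset.map_congr rfl fun i hi => ?_
    rw [Multiset.mem_range] at hi
    rw [hgap, Nat.mod_eq_of_lt hi]
  · have h1 := hgap t
    rw [hle t le_rfl] at h1
    simp at h1
    linarith

/-- With respect to the weight `φ`, the set `A` is a window of at most `card T + 1 + ρ` consecutive
terms of a gap sequence for `T`, and at least `card T + 1`. -/
def IsWindow {α : Type*} (T : Multiset ℤ) (ρ : ℕ) (φ : α → ℤ) (A : Set α) : Prop :=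
  ∃ r ≤ ρ, ∃ c, IsGapSeq T c ∧ ∃ e : ℕ → α,
    A = e '' Set.Iio (Multiset.card T + 1 + r) ∧ ∀ i < Multiset.card T + 1 + r, φ (e i) = c i

theorem IsWindow.image {α β : Type*} {T : Multiset ℤ} {ρ : ℕ} {φ : α → ℤ} {ψ : β → ℤ} {A : Set α}
    (h : IsWindow T ρ φ A) (E : α → β) (a : ℤ) (hE : ∀ x ∈ A, ψ (E x) = φ x + a) :
    IsWindow T ρ ψ (E '' A) := by
  obtain ⟨r, hr, c, hc, e, rfl, he⟩ := h
  refine ⟨r, hr, _, hc.add_const a, E ∘ e, ?_, fun i hi => ?_⟩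
  · rw [Set.image_comp]
  · rw [Function.comp, hE _ (Set.mem_image_of_mem _ hi), he i hi]

theorem IsWindow.isTile {T : Multiset ℤ} {A : Set ℤ} (h : IsWindow T 0 id A) :
    IsTileWithGapSet T A := by
  obtain ⟨r, hr, c, hc, e, rfl, he⟩ := h
  obtain rfl : r = 0 := by omega
  refine ⟨Multiset.card T, fun i => c i, fun i j hij => hc.strictMono hij, ?_, ?_⟩
  · ext x
    simp only [Set.mem_range, Set.mem_image, Set.mem_Iio]
    constructor
    · rintro ⟨i, rfl⟩; exact ⟨i, i.2, by simpa using he i i.2⟩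
    · rintro ⟨i, hi, rfl⟩; exact ⟨⟨i, hi⟩, by simpa using (he i hi).symm⟩
  · conv_rhs => rw [← hc.map_eq]
    unfold gapSet
    have h2 := congrArg Finset.val (Fin.map_valEmbedding_univ (n := Multiset.card T))
    rw [Nat.Iio_eq_range, Finset.range_val, Finset.map_val] at h2
    rw [← h2, Multiset.map_map]
    rfl

/-! ### Lattice paths -/

/-- `B` is the trace of a lattice path with unit steps to the right and upwards, with `t` steps to
the right and `m` steps upwards. If `ρ = 1`, one more step upwards is allowed, provided that then
both the first and the last step go upwards. -/
def IsPath (t m ρ : ℕ) (B : Set (ℕ × ℕ)) : Prop :=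
  ∃ r ≤ ρ, ∃ e : ℕ → ℕ × ℕ,
    (∀ i < t + m + r, e (i + 1) = e i + (1, 0) ∨ e (i + 1) = e i + (0, 1)) ∧
    e (t + m + r) = e 0 + (t, m + r) ∧
    (r ≠ 0 → e 1 = e 0 + (0, 1) ∧ e (t + m + 1) = e (t + m) + (0, 1)) ∧
    B = e '' Set.Iio (t + m + 1 + r)

/-- The gaps along a lattice path, in the weight `u x + v z`, are those of `u` and `v` over the
ranges which the path covers. -/
theorem map_gaps_path (u v : ℕ → ℤ) (e : ℕ → ℕ × ℕ) (L : ℕ)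
    (he : ∀ i < L, e (i + 1) = e i + (1, 0) ∨ e (i + 1) = e i + (0, 1)) :
    ∃ a b, e L = e 0 + (a, b) ∧
      (Multiset.range L).map
          (fun i => (u (e (i + 1)).1 + v (e (i + 1)).2) - (u (e i).1 + v (e i).2)) =
        (Multiset.range a).map (fun i => u (i + 1 + (e 0).1) - u (i + (e 0).1)) +
        (Multiset.range b).map (fun i => v (i + 1 + (e 0).2) - v (i + (e 0).2)) := by
  induction L with
  | zero => exact ⟨0, 0, by simp, by simp⟩
  | succ L ih =>
    obtain ⟨a, b, hab, hm⟩ := ih fun i hi => he i (by omega)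
    rw [Multiset.range_succ, Multiset.map_cons, hm]
    rcases he L (by omega) with h | h
    · refine ⟨a + 1, b, by rw [h, hab]; ext <;> simp [add_assoc], ?_⟩
      rw [Multiset.range_succ, Multiset.map_cons, Multiset.cons_add, h, hab]
      congr 1
      simp only [Prod.fst_add, Prod.snd_add]
      ring_nf
    · refine ⟨a, b + 1, by rw [h, hab]; ext <;> simp [add_assoc], ?_⟩
      rw [Multiset.range_succ, Multiset.map_cons, Multiset.add_cons, h, hab]
      congr 1
      simp only [Prod.fst_add, Prod.snd_add]
      ring_nf

/-- Along a path the weight `u x + v z` starts a gap sequence for the union of the two gap sets. -/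
theorem exists_isGapSeq_path {T V : Multiset ℤ} {u v : ℕ → ℤ} {r : ℕ} (hr : r ≤ 1)
    (hV : 0 < Multiset.card V) (hu : IsGapSeq T u) (hv : IsGapSeq V v) (e : ℕ → ℕ × ℕ)
    (he : ∀ i < Multiset.card T + Multiset.card V + r,
      e (i + 1) = e i + (1, 0) ∨ e (i + 1) = e i + (0, 1))
    (hend : e (Multiset.card T + Multiset.card V + r) =
      e 0 + (Multiset.card T, Multiset.card V + r))
    (hr1 : r ≠ 0 → e 1 = e 0 + (0, 1) ∧ e (Multiset.card T + Multiset.card V + 1) =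
      e (Multiset.card T + Multiset.card V) + (0, 1)) :
    ∃ c, IsGapSeq (T + V) c ∧
      ∀ i < Multiset.card T + Multiset.card V + 1 + r, u (e i).1 + v (e i).2 = c i := by
  have hmid : e (Multiset.card T + Multiset.card V) =
      e 0 + (Multiset.card T, Multiset.card V) := by
    rcases Nat.eq_zero_or_pos r with rfl | hr0
    · simpa using hend
    · obtain rfl : r = 1 := by omega
      obtain ⟨-, h2⟩ := hr1 one_ne_zero
      rw [h2] at hend
      have h3 := congrArg Prod.fst hend
      have h4 := congrArg Prod.snd hend
      simp only [Prod.fst_add, Prod.snd_add] at h3 h4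
      ext <;> simp only [Prod.fst_add, Prod.snd_add] <;> omega
  set f : ℕ → ℤ := fun i => u (e i).1 + v (e i).2 with hf
  obtain ⟨c, hc, hcf, hc1⟩ := exists_isGapSeq f
      (t := Multiset.card T + Multiset.card V) (by omega) (fun i hi => by
        simp only [hf]
        rcases he i (by omega) with h | h
        · rw [h]; simpa using hu.strictMono (Nat.lt_succ_self _)
        · rw [h]; simpa using hv.strictMono (Nat.lt_succ_self _))
  have hmap : (Multiset.range (Multiset.card T + Multiset.card V)).map
      (fun i => f (i + 1) - f i) = T + V := by
    obtain ⟨a, b, hab, hm⟩ := map_gaps_path u v e (Multiset.card T + Multiset.card V)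
      fun i hi => he i (by omega)
    rw [hmid, add_right_inj, Prod.mk.injEq] at hab
    obtain ⟨rfl, rfl⟩ := hab
    rw [hm]
    exact congrArg₂ _ (hu.shift _).map_eq (hv.shift _).map_eq
  rw [hmap] at hc
  refine ⟨c, hc, fun i hi => ?_⟩
  rcases Nat.lt_or_ge (Multiset.card T + Multiset.card V) i with h | h
  · have hr0 : r = 1 := by omega
    obtain rfl : i = Multiset.card T + Multiset.card V + 1 := by omega
    obtain ⟨h1, h2⟩ := hr1 (by omega)
    refine (hc1 ?_).symm
    simp only [hf]
    rw [h1, h2, hmid]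
    -- The first and the last gap agree, being one period of `v` apart.
    have := hv.periodic (e 0).2
    simp only [Prod.fst_add, Prod.snd_add, add_zero]
    linarith
  · exact (hcf i h).symm

theorem IsPath.isWindow {α : Type*} {T V : Multiset ℤ} {u v : ℕ → ℤ} {ρ : ℕ} {B : Set (ℕ × ℕ)}
    (hB : IsPath (Multiset.card T) (Multiset.card V) ρ B) (hρ : ρ ≤ 1)
    (hV : 0 < Multiset.card V) (hu : IsGapSeq T u) (hv : IsGapSeq V v) (E : ℕ × ℕ → α) (φ : α → ℤ)
    (hE : ∀ p ∈ B, φ (E p) = u p.1 + v p.2) : IsWindow (T + V) ρ φ (E '' B) := by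
  obtain ⟨r, hr, e, he, hend, hr1, rfl⟩ := hB
  obtain ⟨c, hc, hce⟩ := exists_isGapSeq_path (hr.trans hρ) hV hu hv e he hend hr1
  refine ⟨r, hr, c, hc, E ∘ e, by rw [Set.image_comp, Multiset.card_add], fun i hi => ?_⟩
  rw [Multiset.card_add] at hi
  rw [Function.comp, hE _ (Set.mem_image_of_mem _ hi), hce i hi]

/-- A path may be given by its horizontal position `X s` as a function of the sum `s` of the two
coordinates. -/
theorem isPath_of_column (X : ℕ → ℕ) {t m ρ a r : ℕ} (hr : r ≤ ρ) (hXs : ∀ s, X s ≤ s)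
    (hX : ∀ s, a ≤ s → s < a + (t + m + r) → X (s + 1) = X s ∨ X (s + 1) = X s + 1)
    (hend : X (a + (t + m + r)) = X a + t)
    (hr1 : r ≠ 0 → X (a + 1) = X a ∧ X (a + (t + m + 1)) = X (a + (t + m))) :
    IsPath t m ρ {p | a ≤ p.1 + p.2 ∧ p.1 + p.2 < a + (t + m + 1 + r) ∧
      p.1 = X (p.1 + p.2)} := by
  refine ⟨r, hr, fun i => (X (a + i), a + i - X (a + i)), ?_, ?_, ?_, ?_⟩
  · intro i hi
    have h1 := hXs (a + i)
    have h2 := hXs (a + (i + 1))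
    rcases hX (a + i) (by omega) (by omega) with h | h
    · right
      rw [add_assoc] at h
      simp only [Prod.mk_add_mk, Prod.mk.injEq]; omega
    · left
      rw [add_assoc] at h
      simp only [Prod.mk_add_mk, Prod.mk.injEq]; omega
  · have h1 := hXs a
    have h2 := hXs (a + (t + m + r))
    simp only [Prod.mk_add_mk, Prod.mk.injEq, add_zero]; omega
  · intro h0
    obtain ⟨h3, h4⟩ := hr1 h0
    have h1 := hXs a
    have h2 := hXs (a + (t + m))
    simp only [Prod.mk_add_mk, Prod.mk.injEq, add_zero]; omega
  · ext ⟨x, z⟩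
    simp only [Set.mem_ofPred_eq, Set.mem_image, Set.mem_Iio, Prod.mk.injEq]
    constructor
    · rintro ⟨h1, h2, h3⟩
      refine ⟨x + z - a, by omega, ?_⟩
      have : a + (x + z - a) = x + z := by omega
      rw [this]; omega
    · rintro ⟨i, hi, rfl, rfl⟩
      have := hXs (a + i)
      have h : X (a + i) + (a + i - X (a + i)) = a + i := by omega
      rw [h]; omega

/-! ### Tiling a strip by lattice paths -/

/-- For a sequence `β` increasing from `0`, let `J s` be the index with `β (J s) ≤ s < β (J s + 1)`.
-/
theorem exists_index {β : ℕ → ℕ} (hβ : StrictMono β) (h0 : β 0 = 0) :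
    ∃ J : ℕ → ℕ, (∀ j s, β j ≤ s ↔ j ≤ J s) ∧ (∀ s, J s ≤ s) ∧
      ∀ s, J (s + 1) = J s ∨ J (s + 1) = J s + 1 := by
  have hle : ∀ j, j ≤ β j := hβ.id_le
  have key : ∃ J : ℕ → ℕ, ∀ j s, β j ≤ s ↔ j ≤ J s := by
    refine ⟨fun s => Nat.findGreatest (fun j => β j ≤ s) s, fun j s => ⟨fun h => ?_, fun h => ?_⟩⟩
    · exact Nat.le_findGreatest ((hle j).trans h) h
    · have := Nat.findGreatest_spec (P := fun j => β j ≤ s) (m := 0) (n := s) (by omega)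
        (by simp [h0])
      exact (hβ.monotone h).trans this
  obtain ⟨J, hJ⟩ := key
  refine ⟨J, hJ, fun s => (hle _).trans ((hJ _ _).2 le_rfl), fun s => ?_⟩
  have h1 : J s ≤ J (s + 1) := (hJ _ _).1 (((hJ _ _).2 le_rfl).trans (Nat.le_succ s))
  have h2 : J (s + 1) ≤ J s + 1 := by
    by_contra! h
    have h3 : β (J s + 2) ≤ s + 1 := (hJ _ _).2 h
    have h4 : β (J s + 1) < β (J s + 2) := hβ (by omega)
    have h5 := (hJ (J s + 1) s).1 (by omega)
    omega
  omega

/-- Let `β` be increasing, and let the path number `i` meet the column `x` in the cells `(x, z)`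
with `β (i + x) ≤ x + z < β (i + x + 1)`. These paths partition a strip of `t + 1` columns. -/
theorem tiled_strip {t m ρ : ℕ} (hρ : ρ ≤ 1) {β : ℕ → ℕ} (hβ : StrictMono β)
    (h0 : β 0 = 0) {i₀ i₁ : ℕ}
    (h : ∀ i, i₀ ≤ i → i < i₁ → β (i + t + 1) = β i + (t + m + 1) ∨
      (ρ = 1 ∧ β (i + t + 1) = β i + (t + m + 2) ∧ β i + 2 ≤ β (i + 1) ∧
        β (i + t) + 2 ≤ β (i + t + 1))) :
    Tiled (IsPath t m ρ)
      {p | p.1 < t + 1 ∧ β (i₀ + p.1) ≤ p.1 + p.2 ∧ p.1 + p.2 < β (i₁ + p.1)} := by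
  obtain ⟨J, hJ, hJs, hJ1⟩ := exists_index hβ h0
  have hJ' : ∀ j s, s < β j ↔ J s < j := fun j s => by rw [← not_le, hJ, not_le]
  have hJβ : ∀ j, J (β j) = j := fun j => le_antisymm
    (hβ.le_iff_le.1 ((hJ _ _).2 le_rfl)) ((hJ _ _).1 le_rfl)
  refine Tiled.of_fibres (fun p => J (p.1 + p.2) - p.1) ?_
  rintro ⟨x₀, z₀⟩ ⟨hx, h1, h2⟩
  simp only at hx h1 h2 ⊢
  rw [hJ] at h1
  rw [hJ'] at h2
  obtain ⟨i, hi⟩ : ∃ i, J (x₀ + z₀) - x₀ = i := ⟨_, rfl⟩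
  have hi0 : i₀ ≤ i := by omega
  have hi1 : i < i₁ := by omega
  rw [hi]
  apply Tiled.of
  have key : ∀ r ≤ ρ, β (i + t + 1) = β i + (t + m + 1 + r) →
      (r ≠ 0 → β i + 2 ≤ β (i + 1) ∧ β (i + t) + 2 ≤ β (i + t + 1)) →
      IsPath t m ρ {p | β i ≤ p.1 + p.2 ∧ p.1 + p.2 < β i + (t + m + 1 + r) ∧
        p.1 = J (p.1 + p.2) - i} := by
    intro r hr hb hr1
    have hlast : J (β i + (t + m + r)) = i + t := by
      have h3 := (hJ' (i + t + 1) (β i + (t + m + r))).1 (by omega)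
      have h4 := hJ1 (β i + (t + m + r))
      have h5 : β i + (t + m + r) + 1 = β (i + t + 1) := by omega
      rw [h5, hJβ] at h4
      omega
    refine isPath_of_column (fun s => J s - i) hr (fun s => (Nat.sub_le _ _).trans (hJs s))
      (fun s hs _ => ?_) ?_ fun hr0 => ?_
    · have := (hJ i s).1 hs
      have := hJ1 s
      omega
    · rw [hlast, hJβ]; omega
    · obtain ⟨h3, h4⟩ := hr1 hr0
      obtain rfl : r = 1 := by omega
      have h5 := (hJ' (i + 1) (β i + 1)).1 (by omega)
      have h6 := (hJ' (i + t + 1) (β i + (t + m))).1 (by omega)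
      have h7 := (hJ (i + t) (β i + (t + m))).1 (by omega)
      rw [hlast, hJβ]; omega
  have hset : ∀ r, β (i + t + 1) = β i + (t + m + 1 + r) →
      {y : ℕ × ℕ | y ∈ {p : ℕ × ℕ | p.1 < t + 1 ∧ β (i₀ + p.1) ≤ p.1 + p.2 ∧
        p.1 + p.2 < β (i₁ + p.1)} ∧ J (y.1 + y.2) - y.1 = i} =
      {p | β i ≤ p.1 + p.2 ∧ p.1 + p.2 < β i + (t + m + 1 + r) ∧
        p.1 = J (p.1 + p.2) - i} := by
    intro r hb
    rw [← hb]
    ext ⟨x, z⟩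
    simp only [Set.mem_ofPred_eq, hJ, hJ']
    omega
  rcases h i hi0 hi1 with hb | ⟨hρ1, hb, hb1, hb2⟩
  · rw [hset 0 hb]
    exact key 0 (by omega) hb (by simp)
  · rw [hset 1 (by omega)]
    exact key 1 (by omega) (by omega) fun _ => ⟨hb1, hb2⟩

/-- The cell of `tiled_wide_strip` in column `x` whose coordinate sum has index `j` lies on the
path whose number is given on the left; on the right are the cells of the path number `i`. -/
theorem wide_strip_index {t k₀ k₁ i x j : ℕ} (h0 : k₀ + k₀ ≤ i) (h1 : i < k₁ + k₁) :
    ((x < t + 2 ∧ k₀ + k₀ + x ≤ j ∧ j < k₁ + k₁ + x) ∧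
      (if x = 0 then 2 * (j / 2) else if x = t + 1 then 2 * ((j - x) / 2) + 1 else
        if (j - x) % 2 = 0 then j - x + 1 else j - x - 1) = i) ↔
    i ≤ j ∧ j < i + t + 2 ∧
      x = if i % 2 = 0 then j - i - 1 else min (j - (i - 1)) (t + 1) := by
  rcases Nat.even_or_odd' i with ⟨k, rfl | rfl⟩
  · rw [if_pos (show 2 * k % 2 = 0 by omega)]
    rcases Nat.eq_zero_or_pos x with rfl | hx
    · rw [if_pos rfl]; omega
    · rw [if_neg (by omega)]
      rcases eq_or_ne x (t + 1) with rfl | hx'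
      · rw [if_pos rfl]; omega
      · rw [if_neg hx']
        split_ifs <;> omega
  · rw [if_neg (show ¬ (2 * k + 1) % 2 = 0 by omega)]
    rcases Nat.eq_zero_or_pos x with rfl | hx
    · rw [if_pos rfl]; omega
    · rw [if_neg (by omega)]
      rcases eq_or_ne x (t + 1) with rfl | hx'
      · rw [if_pos rfl]; omega
      · rw [if_neg hx']
        split_ifs <;> omega

/-- Here the strip has one column more than a path covers: the path number `2 k` covers the
columns `0, …, t` and waits in column `0`, the path number `2 k + 1` covers the columns
`1, …, t + 1` and waits in column `t + 1`. -/
theorem tiled_wide_strip {t m ρ : ℕ} (hρ : ρ ≤ 1) {β : ℕ → ℕ} (hβ : StrictMono β)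
    (h0 : β 0 = 0) {i₀ i₁ : ℕ} (he0 : Even i₀) (he1 : Even i₁)
    (h : ∀ i, i₀ ≤ i → i < i₁ → β (i + t + 2) = β i + (t + m + 1) ∨
      (ρ = 1 ∧ β (i + t + 2) = β i + (t + m + 2) ∧ β i + 2 ≤ β (i + 1) ∧
        β (i + t + 1) + 2 ≤ β (i + t + 2))) :
    Tiled (IsPath t m ρ)
      {p | p.1 < t + 2 ∧ β (i₀ + p.1) ≤ p.1 + p.2 ∧ p.1 + p.2 < β (i₁ + p.1)} := by
  obtain ⟨J, hJ, hJs, hJ1⟩ := exists_index hβ h0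
  have hJ' : ∀ j s, s < β j ↔ J s < j := fun j s => by rw [← not_le, hJ, not_le]
  have hJβ : ∀ j, J (β j) = j := fun j => le_antisymm
    (hβ.le_iff_le.1 ((hJ _ _).2 le_rfl)) ((hJ _ _).1 le_rfl)
  obtain ⟨k₀, rfl⟩ := he0
  obtain ⟨k₁, rfl⟩ := he1
  -- The horizontal position of the path number `i`.
  set X : ℕ → ℕ → ℕ := fun i s =>
    if i % 2 = 0 then J s - i - 1 else min (J s - (i - 1)) (t + 1) with hX
  set idx : ℕ × ℕ → ℕ := fun p =>
    if p.1 = 0 then 2 * (J (p.1 + p.2) / 2) else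
    if p.1 = t + 1 then 2 * ((J (p.1 + p.2) - p.1) / 2) + 1 else
    if (J (p.1 + p.2) - p.1) % 2 = 0 then J (p.1 + p.2) - p.1 + 1
    else J (p.1 + p.2) - p.1 - 1 with hidx
  refine Tiled.of_fibres idx ?_
  rintro ⟨x₀, z₀⟩ ⟨hx, h1, h2⟩
  simp only at hx h1 h2 ⊢
  rw [hJ] at h1
  rw [hJ'] at h2
  obtain ⟨i, hi⟩ : ∃ i, idx (x₀, z₀) = i := ⟨_, rfl⟩
  have hi0 : k₀ + k₀ ≤ i ∧ i < k₁ + k₁ := by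
    rw [← hi]
    simp only [hidx]
    split_ifs <;> omega
  rw [hi]
  apply Tiled.of
  have key : ∀ r ≤ ρ, β (i + t + 2) = β i + (t + m + 1 + r) →
      (r ≠ 0 → β i + 2 ≤ β (i + 1) ∧ β (i + t + 1) + 2 ≤ β (i + t + 2)) →
      IsPath t m ρ {p | β i ≤ p.1 + p.2 ∧ p.1 + p.2 < β i + (t + m + 1 + r) ∧
        p.1 = X i (p.1 + p.2)} := by
    intro r hr hb hr1
    have hlast : J (β i + (t + m + r)) = i + t + 1 := by
      have h3 := (hJ' (i + t + 2) (β i + (t + m + r))).1 (by omega)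
      have h4 := hJ1 (β i + (t + m + r))
      have h5 : β i + (t + m + r) + 1 = β (i + t + 2) := by omega
      rw [h5, hJβ] at h4
      omega
    have hmin : ∀ s, min (J s - (i - 1)) (t + 1) ≤ s := fun s =>
      (min_le_left _ _).trans ((Nat.sub_le _ _).trans (hJs s))
    refine isPath_of_column (X i) hr (fun s => ?_)
      (fun s hs _ => ?_) ?_ fun hr0 => ?_
    · have := hJs s
      simp only [hX]; split_ifs <;> omega
    · have := (hJ i s).1 hs
      have := hJ1 s
      simp only [hX]; split_ifs <;> omega
    · simp only [hX]
      rw [hlast, hJβ]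
      split_ifs <;> omega
    · obtain ⟨h3, h4⟩ := hr1 hr0
      obtain rfl : r = 1 := by omega
      have h5 := (hJ' (i + 1) (β i + 1)).1 (by omega)
      have h6 := (hJ' (i + t + 2) (β i + (t + m))).1 (by omega)
      have h7 := (hJ (i + t + 1) (β i + (t + m))).1 (by omega)
      have h8 := (hJ i (β i + 1)).1 (by omega)
      simp only [hX]
      rw [hlast, hJβ]
      split_ifs <;> omega
  have hset : ∀ r, β (i + t + 2) = β i + (t + m + 1 + r) →
      {y : ℕ × ℕ | y ∈ {p : ℕ × ℕ | p.1 < t + 2 ∧ β (k₀ + k₀ + p.1) ≤ p.1 + p.2 ∧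
        p.1 + p.2 < β (k₁ + k₁ + p.1)} ∧ idx y = i} =
      {p | β i ≤ p.1 + p.2 ∧ p.1 + p.2 < β i + (t + m + 1 + r) ∧
        p.1 = X i (p.1 + p.2)} := by
    intro r hb
    rw [← hb]
    ext ⟨x, z⟩
    simp only [Set.mem_ofPred_eq, hJ, hJ', hidx, hX]
    exact wide_strip_index hi0.1 hi0.2
  rcases h i hi0.1 hi0.2 with hb | ⟨hρ1, hb, hb1, hb2⟩
  · rw [hset 0 hb]
    exact key 0 (by omega) hb (by simp)
  · rw [hset 1 (by omega)]
    exact key 1 (by omega) (by omega) fun _ => ⟨hb1, hb2⟩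

/-! ### Rectangles and staircases -/

theorem div_mul_add_mod_shift {W i : ℕ} (hW : 0 < W) :
    (i + W) / W = i / W + 1 ∧ (i + W) % W = i % W :=
  ⟨Nat.add_div_right i hW, Nat.add_mod_right i W⟩

theorem succ_div_mod {W i : ℕ} (hW : 0 < W) :
    (i % W + 1 < W ∧ (i + 1) / W = i / W ∧ (i + 1) % W = i % W + 1) ∨
    (i % W + 1 = W ∧ (i + 1) / W = i / W + 1 ∧ (i + 1) % W = 0) := by
  have hi := Nat.div_add_mod i W
  have hlt := Nat.mod_lt i hW
  rcases Nat.lt_or_ge (i % W + 1) W with h | h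
  · refine Or.inl ⟨h, ?_, ?_⟩
    · conv_lhs => rw [← hi, add_assoc, Nat.mul_add_div hW, Nat.div_eq_of_lt h, add_zero]
    · conv_lhs => rw [← hi, add_assoc, Nat.mul_add_mod, Nat.mod_eq_of_lt h]
  · have h0 : i % W + 1 = W := by omega
    refine Or.inr ⟨h0, ?_, ?_⟩
    · conv_lhs => rw [← hi, add_assoc, h0, Nat.mul_add_div hW, Nat.div_self hW]
    · conv_lhs => rw [← hi, add_assoc, h0]; simp

/-- A boundary function for strips of `W` columns: all its paths have `N` cells, and `W` consecutive
paths fill a rectangle of height `N`. -/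
def flatBound (W N i : ℕ) : ℕ := i / W * N + i % W

/-- A boundary function for strips of `W` columns. In each of the first `W` rounds of `W` paths, one
path has `N + 1` cells and the others have `N`; after these rounds the upper boundary is horizontal
again, at a height which is raised by one. -/
def raisedBound (W N i : ℕ) : ℕ :=
  i / W * N + i % W + if W ≤ i / W + i % W then 1 else 0

theorem flatBound_add {W N : ℕ} (hW : 0 < W) (i : ℕ) :
    flatBound W N (i + W) = flatBound W N i + N := by
  obtain ⟨h1, h2⟩ := div_mul_add_mod_shift (i := i) hW
  rw [flatBound, h1, h2, flatBound]; ring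

theorem flatBound_of_lt {W N l q : ℕ} (hq : q < W) : flatBound W N (l * W + q) = l * N + q := by
  have h1 : (l * W + q) / W = l := by
    rw [mul_comm, Nat.mul_add_div (by omega), Nat.div_eq_of_lt hq, add_zero]
  have h2 : (l * W + q) % W = q := by
    rw [mul_comm, Nat.mul_add_mod, Nat.mod_eq_of_lt hq]
  rw [flatBound, h1, h2]

theorem raisedBound_of_lt {W N l q : ℕ} (hq : q < W) :
    raisedBound W N (l * W + q) = l * N + q + if W ≤ l + q then 1 else 0 := by
  have h1 : (l * W + q) / W = l := by
    rw [mul_comm, Nat.mul_add_div (by omega), Nat.div_eq_of_lt hq, add_zero]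
  have h2 : (l * W + q) % W = q := by
    rw [mul_comm, Nat.mul_add_mod, Nat.mod_eq_of_lt hq]
  rw [raisedBound, h1, h2]

theorem flatBound_strictMono {W N : ℕ} (hW : 0 < W) (hN : W ≤ N) : StrictMono (flatBound W N) := by
  refine strictMono_nat_of_lt_succ fun i => ?_
  rcases succ_div_mod (i := i) hW with ⟨h, h1, h2⟩ | ⟨h, h1, h2⟩
  · rw [flatBound, flatBound, h1, h2]; omega
  · rw [flatBound, flatBound, h1, h2, add_mul]; omega

theorem raisedBound_strictMono {W N : ℕ} (hW : 0 < W) (hN : W + 1 ≤ N) :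
    StrictMono (raisedBound W N) := by
  refine strictMono_nat_of_lt_succ fun i => ?_
  rcases succ_div_mod (i := i) hW with ⟨h, h1, h2⟩ | ⟨h, h1, h2⟩
  · rw [raisedBound, raisedBound, h1, h2]; split_ifs <;> omega
  · rw [raisedBound, raisedBound, h1, h2, add_mul]; split_ifs <;> omega

theorem raisedBound_add {W N : ℕ} (hW : 2 ≤ W) (hN : W + 1 ≤ N) (i : ℕ) :
    raisedBound W N (i + W) = raisedBound W N i + N ∨
    (raisedBound W N (i + W) = raisedBound W N i + N + 1 ∧
      raisedBound W N i + 2 ≤ raisedBound W N (i + 1) ∧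
      raisedBound W N (i + W - 1) + 2 ≤ raisedBound W N (i + W)) := by
  have hi := Nat.div_add_mod i W
  have hlt := Nat.mod_lt i (show 0 < W by omega)
  generalize i / W = l at hi
  generalize i % W = q at hi hlt
  rw [mul_comm] at hi
  subst hi
  have e1 : l * W + q + W = (l + 1) * W + q := by ring
  rw [e1, raisedBound_of_lt hlt, raisedBound_of_lt hlt, add_mul]
  by_cases hc : l + q + 1 = W
  · right
    rw [if_pos (show W ≤ l + 1 + q by omega), if_neg (show ¬ W ≤ l + q by omega)]
    refine ⟨by omega, ?_, ?_⟩
    · rcases Nat.lt_or_ge (q + 1) W with h | h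
      · rw [add_assoc (l * W), raisedBound_of_lt h, if_pos (by omega)]; omega
      · have e2 : l * W + q + 1 = (l + 1) * W + 0 := by rw [add_mul]; omega
        rw [e2, raisedBound_of_lt (by omega), add_mul]
        split_ifs <;> omega
    · rcases Nat.eq_zero_or_pos q with rfl | h
      · have e2 : (l + 1) * W + 0 - 1 = l * W + (W - 1) := by rw [add_mul]; omega
        rw [e2, raisedBound_of_lt (by omega), if_pos (by omega)]; omega
      · have e2 : (l + 1) * W + q - 1 = (l + 1) * W + (q - 1) := by omega
        rw [e2, raisedBound_of_lt (by omega), if_neg (by omega), add_mul]; omega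
  · left
    split_ifs <;> omega

/-- Rectangles with `t + 1 + r` columns, for `r ≤ 1`, whose height is an even multiple of
`t + m + 1`. -/
theorem tiled_rect_exact {t m r : ℕ} (hr : r ≤ 1) (hm : 0 < m) {l : ℕ} (hl : Even l) :
    Tiled (IsPath t m 0) {p | p.1 < t + 1 + r ∧ p.2 < l * (t + m + 1)} := by
  have hmono := flatBound_strictMono (W := t + 1 + r) (N := t + m + 1) (by omega) (by omega)
  have h0 : flatBound (t + 1 + r) (t + m + 1) 0 = 0 := by simp [flatBound]
  have hadd := flatBound_add (W := t + 1 + r) (N := t + m + 1) (by omega)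
  have hlo : ∀ x < t + 1 + r, flatBound (t + 1 + r) (t + m + 1) (0 + x) = x := fun x hx => by
    have := flatBound_of_lt (N := t + m + 1) (l := 0) hx
    simpa using this
  have hhi : ∀ x < t + 1 + r, flatBound (t + 1 + r) (t + m + 1) (l * (t + 1 + r) + x) =
      l * (t + m + 1) + x := fun x hx => flatBound_of_lt hx
  have hset : {p : ℕ × ℕ | p.1 < t + 1 + r ∧ p.2 < l * (t + m + 1)} =
      {p | p.1 < t + 1 + r ∧ flatBound (t + 1 + r) (t + m + 1) (0 + p.1) ≤ p.1 + p.2 ∧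
        p.1 + p.2 < flatBound (t + 1 + r) (t + m + 1) (l * (t + 1 + r) + p.1)} := by
    ext ⟨x, z⟩
    simp only [Set.mem_ofPred_eq]
    refine and_congr_right fun hx => ?_
    rw [hlo x hx, hhi x hx]; omega
  rw [hset]
  rcases Nat.le_one_iff_eq_zero_or_eq_one.1 hr with rfl | rfl
  · exact tiled_strip (by omega) hmono h0 fun i _ _ => Or.inl (hadd i)
  · exact tiled_wide_strip (by omega) hmono h0 (by simp) (hl.mul_right _)
      fun i _ _ => Or.inl (hadd i)

/-- With windows that may be longer by one, also heights `1` modulo `2 (t + m + 1)` are possible.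
The condition `r + 1 ≤ m` makes `raisedBound` increasing. -/
theorem tiled_rect_raised {t m r : ℕ} (hr : r ≤ 1) (ht : 0 < t) (hm : r + 1 ≤ m) {l : ℕ}
    (hl : Even l) (hlt : t + 1 + r ≤ l) :
    Tiled (IsPath t m 1) {p | p.1 < t + 1 + r ∧ p.2 < l * (t + m + 1) + 1} := by
  have hmono := raisedBound_strictMono (W := t + 1 + r) (N := t + m + 1) (by omega) (by omega)
  have h0 : raisedBound (t + 1 + r) (t + m + 1) 0 = 0 := by simp [raisedBound]
  have hadd := raisedBound_add (W := t + 1 + r) (N := t + m + 1) (by omega) (by omega)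
  have hlo : ∀ x < t + 1 + r, raisedBound (t + 1 + r) (t + m + 1) (0 + x) = x := fun x hx => by
    have := raisedBound_of_lt (N := t + m + 1) (l := 0) hx
    rw [if_neg (by omega)] at this
    simpa using this
  have hhi : ∀ x < t + 1 + r, raisedBound (t + 1 + r) (t + m + 1) (l * (t + 1 + r) + x) =
      l * (t + m + 1) + x + 1 := fun x hx => by
    rw [raisedBound_of_lt hx, if_pos (by omega)]
  have hset : {p : ℕ × ℕ | p.1 < t + 1 + r ∧ p.2 < l * (t + m + 1) + 1} =
      {p | p.1 < t + 1 + r ∧ raisedBound (t + 1 + r) (t + m + 1) (0 + p.1) ≤ p.1 + p.2 ∧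
        p.1 + p.2 < raisedBound (t + 1 + r) (t + m + 1) (l * (t + 1 + r) + p.1)} := by
    ext ⟨x, z⟩
    simp only [Set.mem_ofPred_eq]
    refine and_congr_right fun hx => ?_
    rw [hlo x hx, hhi x hx]; omega
  rw [hset]
  rcases Nat.le_one_iff_eq_zero_or_eq_one.1 hr with rfl | rfl
  · exact tiled_strip (by omega) hmono h0 fun i _ _ => (hadd i).imp_right fun h => ⟨rfl, h⟩
  · exact tiled_wide_strip (by omega) hmono h0 (by simp) (hl.mul_right _)
      fun i _ _ => (hadd i).imp_right fun h => ⟨rfl, h⟩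

theorem IsPath.add {t m ρ : ℕ} {B : Set (ℕ × ℕ)} (h : IsPath t m ρ B) (a : ℕ × ℕ) :
    IsPath t m ρ ((· + a) '' B) := by
  obtain ⟨r, hr, e, he, hend, hr1, rfl⟩ := h
  refine ⟨r, hr, fun i => e i + a, fun i hi => ?_, ?_, fun h0 => ?_, ?_⟩
  · rcases he i hi with h | h
    · left; simp only [h]; abel
    · right; simp only [h]; abel
  · simp only [hend]; abel
  · obtain ⟨h1, h2⟩ := hr1 h0
    simp only [h1, h2]
    exact ⟨by abel, by abel⟩
  · rw [← Set.image_comp]; rfl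

theorem IsPath.mono {t m ρ ρ' : ℕ} {B : Set (ℕ × ℕ)} (h : IsPath t m ρ B) (hρ : ρ ≤ ρ') :
    IsPath t m ρ' B := by
  obtain ⟨r, hr, h⟩ := h
  exact ⟨r, hr.trans hρ, h⟩

theorem Tiled.isPath_add {t m ρ : ℕ} {S S' : Set (ℕ × ℕ)} (h : Tiled (IsPath t m ρ) S) (b : ℕ)
    (hS : ∀ x z, (x, z) ∈ S' ↔ b ≤ z ∧ (x, z - b) ∈ S) : Tiled (IsPath t m ρ) S' := by
  have := h.image (Q := IsPath t m ρ) (· + (0, b)) (add_left_injective _).injOn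
    fun A hA _ => hA.add _
  convert this using 1
  ext ⟨x, z⟩
  rw [hS]
  simp only [Set.mem_image, Prod.exists, Prod.mk_add_mk, Prod.mk.injEq, add_zero]
  constructor
  · rintro ⟨h1, h2⟩
    exact ⟨x, z - b, h2, rfl, by omega⟩
  · rintro ⟨x', z', h1, rfl, rfl⟩
    exact ⟨by omega, by simpa using h1⟩

/-- All sufficiently high rectangles with `t + 1 + r` columns can be tiled. -/
theorem exists_tiled_rect {t m r : ℕ} (hr : r ≤ 1) (ht : 0 < t) (hm : r + 1 ≤ m) :
    ∃ H, ∀ h, H ≤ h → Tiled (IsPath t m 1) {p | p.1 < t + 1 + r ∧ p.2 < h} := by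
  set S := {h : ℕ | Tiled (IsPath t m 1) {p | p.1 < t + 1 + r ∧ p.2 < h}} with hS
  have hadd : ∀ a ∈ S, ∀ b ∈ S, a + b ∈ S := by
    intro a ha b hb
    refine Tiled.split (fun p => p.2 < a) ?_ ?_
    · have ha' : Tiled (IsPath t m 1) {p | p.1 < t + 1 + r ∧ p.2 < a} := ha
      convert ha' using 1
      ext p; simp only [Set.mem_ofPred_eq]; omega
    · refine Tiled.isPath_add hb a fun x z => ?_
      simp only [Set.mem_ofPred_eq]; omega
  have h0 : 0 ∈ S := by
    simp only [hS, Set.mem_ofPred_eq, Nat.not_lt_zero, and_false]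
    exact Tiled.empty
  have hmul : ∀ a ∈ S, ∀ k, k * a ∈ S := by
    intro a ha k
    induction k with
    | zero => simpa using h0
    | succ k ih => rw [add_mul, one_mul]; exact hadd _ ih _ ha
  have he : 2 * (t + m + 1) ∈ S :=
    (tiled_rect_exact hr (by omega) even_two).mono fun A hA => hA.mono (by omega)
  have ho : 2 * (t + 2) * (t + m + 1) + 1 ∈ S :=
    tiled_rect_raised hr ht hm (by simp) (by omega)
  refine ⟨2 * (t + m + 1) * (2 * (t + 2) * (t + m + 1) + 1), fun h hh => ?_⟩
  generalize hN : 2 * (t + m + 1) = N at *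
  generalize hM : 2 * (t + 2) * (t + m + 1) + 1 = M at *
  have hM' : M = (t + 2) * N + 1 := by rw [← hM, ← hN]; ring
  have h1 : h % N < N := Nat.mod_lt _ (by omega)
  have h2 := Nat.div_add_mod h N
  have h3 : M ≤ h / N := (Nat.le_div_iff_mul_le (by omega)).2 (by rw [mul_comm]; exact hh)
  have h4 : h % N * (t + 2) ≤ h / N := by
    refine le_trans ?_ h3
    rw [hM', mul_comm (t + 2)]
    have := Nat.mul_le_mul_right (t + 2) h1.le
    omega
  obtain ⟨j, hj⟩ := Nat.exists_eq_add_of_le h4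
  have : h = j * N + h % N * M := by
    rw [hj] at h2
    rw [hM']
    calc h = N * (h % N * (t + 2) + j) + h % N := h2.symm
      _ = _ := by ring
  rw [this]
  exact hadd _ (hmul _ he _) _ (hmul _ ho _)

/-- For `t + 1` columns, also the regions below and above a step of height `m` can be tiled. -/
theorem exists_tiled_step {t m : ℕ} (ht : 0 < t) (hm : 0 < m) :
    ∃ H, ∀ p b, p ≤ t + 1 → H ≤ b →
      Tiled (IsPath t m 1) {q | q.1 < t + 1 ∧ q.2 < b + if p ≤ q.1 then m else 0} ∧
      ∀ K, b + H ≤ K →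
        Tiled (IsPath t m 1) {q | q.1 < t + 1 ∧ (b + if p ≤ q.1 then m else 0) ≤ q.2 ∧
          q.2 < K} := by
  obtain ⟨H, hH⟩ := exists_tiled_rect (r := 0) (t := t) (m := m) (by omega) ht (by omega)
  have hmono := flatBound_strictMono (W := t + 1) (N := t + m + 1) (by omega) (by omega)
  have h0 : flatBound (t + 1) (t + m + 1) 0 = 0 := by simp [flatBound]
  have hadd := flatBound_add (W := t + 1) (N := t + m + 1) (by omega)
  refine ⟨H + (t + m + 1), fun p b hp hb => ?_⟩
  -- The step is the boundary between the path number `j` and the preceding ones.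
  obtain ⟨j, hj⟩ : ∃ j, t + 1 - p = j := ⟨_, rfl⟩
  have hmidle : ∀ x < t + 1, flatBound (t + 1) (t + m + 1) (j + x) =
      x + j + if p ≤ x then m else 0 := fun x hx => by
    split_ifs with h
    · have := flatBound_of_lt (W := t + 1) (N := t + m + 1) (l := 1) (q := j + x - (t + 1))
        (by omega)
      rw [show 1 * (t + 1) + (j + x - (t + 1)) = j + x by omega] at this
      rw [this]; omega
    · have := flatBound_of_lt (W := t + 1) (N := t + m + 1) (l := 0) (q := j + x) (by omega)
      rw [zero_mul, zero_mul, zero_add] at this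
      rw [this]; ring
  have hlo : ∀ x < t + 1, flatBound (t + 1) (t + m + 1) (0 + x) = x := fun x hx => by
    have := flatBound_of_lt (N := t + m + 1) (l := 0) hx
    simpa using this
  have hhi : ∀ x < t + 1, flatBound (t + 1) (t + m + 1) (t + 1 + x) = t + m + 1 + x :=
    fun x hx => by
      have := flatBound_of_lt (N := t + m + 1) (l := 1) hx
      rw [one_mul, one_mul] at this
      exact this
  constructor
  · refine Tiled.split (fun q => q.2 < b - j) ?_ ?_
    · convert hH (b - j) (by omega) using 1
      ext q; simp only [Set.mem_ofPred_eq]; omega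
    · have := tiled_strip (t := t) (m := m) (ρ := 1) le_rfl hmono h0 (i₀ := 0) (i₁ := j)
        fun i _ _ => Or.inl (hadd i)
      refine this.isPath_add (b - j) fun x z => ?_
      simp only [Set.mem_ofPred_eq]
      by_cases hx : x < t + 1
      · rw [hlo x hx, hmidle x hx]; omega
      · simp only [hx, false_and, and_false]
  · intro K hK
    refine Tiled.split (fun q => q.2 < b - j + (t + m + 1)) ?_ ?_
    · have := tiled_strip (t := t) (m := m) (ρ := 1) le_rfl hmono h0 (i₀ := j) (i₁ := t + 1)
        fun i _ _ => Or.inl (hadd i)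
      refine this.isPath_add (b - j) fun x z => ?_
      simp only [Set.mem_ofPred_eq]
      by_cases hx : x < t + 1
      · rw [hhi x hx, hmidle x hx]; split_ifs <;> omega
      · simp only [hx, false_and, and_false]
    · refine Tiled.isPath_add (hH (K - (b - j + (t + m + 1))) (by omega)) (b - j + (t + m + 1))
        fun x z => ?_
      simp only [Set.mem_ofPred_eq]; split_ifs <;> omega

/-! ### Decomposing intervals -/

/-- The class `P` is invariant under translations. -/
def TranslationInvariant (P : Set ℤ → Prop) : Prop := ∀ A a, P A → P ((· + a) '' A)

theorem translationInvariant_isWindow (T : Multiset ℤ) (ρ : ℕ) :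
    TranslationInvariant (IsWindow T ρ id) :=
  fun _ a h => h.image (· + a) a fun _ _ => rfl

theorem Tiled.translate {P : Set ℤ → Prop} (hP : TranslationInvariant P) {a b : ℤ}
    (h : Tiled P (Set.Ico a b)) (s : ℤ) : Tiled P (Set.Ico (a + s) (b + s)) := by
  have := h.image (Q := P) (· + s) (add_left_injective s).injOn fun A hA _ => hP A s hA
  rwa [Set.image_add_const_Ico] at this

theorem Tiled.Ico_add {P : Set ℤ → Prop} (hP : TranslationInvariant P) {m n : ℕ}
    (hm : Tiled P (Set.Ico 0 (m : ℤ))) (hn : Tiled P (Set.Ico 0 (n : ℤ))) :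
    Tiled P (Set.Ico 0 ((m + n : ℕ) : ℤ)) := by
  have h1 := hm.union (hn.translate hP m) (by
    rw [Set.disjoint_left]; intro x hx hx'
    simp only [Set.mem_Ico] at hx hx'; omega)
  convert h1 using 1
  ext x; simp only [Set.mem_Ico, Set.mem_union]; omega

theorem Tiled.Ico_mul {P : Set ℤ → Prop} (hP : TranslationInvariant P) {n : ℕ}
    (hn : Tiled P (Set.Ico 0 (n : ℤ))) (k : ℕ) : Tiled P (Set.Ico 0 ((k * n : ℕ) : ℤ)) := by
  induction k with
  | zero => simpa using Tiled.empty
  | succ k ih => rw [add_mul, one_mul]; exact ih.Ico_add hP hn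

/-- All sufficiently long intervals can be tiled. -/
def TilesLong (P : Set ℤ → Prop) : Prop :=
  ∃ L₀ : ℕ, ∀ L : ℕ, L₀ ≤ L → Tiled P (Set.Ico 0 (L : ℤ))

theorem tilesLong_of_succ {P : Set ℤ → Prop} (hP : TranslationInvariant P) {n : ℕ} (h0 : 0 < n)
    (hn : Tiled P (Set.Ico 0 (n : ℤ))) (hn1 : Tiled P (Set.Ico 0 ((n + 1 : ℕ) : ℤ))) :
    TilesLong P := by
  refine ⟨n * (n - 1), fun L hL => ?_⟩
  obtain ⟨p, q, rfl⟩ := exists_eq_mul_add_mul_succ h0 hL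
  exact (hn.Ico_mul hP p).Ico_add hP (hn1.Ico_mul hP q)

/-- The interval `[0, c)` can be cut into two tiled intervals in two ways, with adjacent places of
the cut. -/
def SplitsTwice (P : Set ℤ → Prop) (c : ℕ) : Prop :=
  ∃ j : ℕ, j + 1 ≤ c ∧ Tiled P (Set.Ico 0 (j : ℤ)) ∧ Tiled P (Set.Ico 0 ((j + 1 : ℕ) : ℤ)) ∧
    Tiled P (Set.Ico 0 ((c - j : ℕ) : ℤ)) ∧ Tiled P (Set.Ico 0 ((c - (j + 1) : ℕ) : ℤ))

theorem TilesLong.exists_splitsTwice {P : Set ℤ → Prop} (h : TilesLong P) :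
    ∃ B, ∀ c, B ≤ c → SplitsTwice P c := by
  obtain ⟨L, hL⟩ := h
  exact ⟨2 * L + 1, fun c hc => ⟨L, by omega, hL _ le_rfl, hL _ (by omega), hL _ (by omega),
    hL _ (by omega)⟩⟩

/-- `A` is the disjoint union of the translates `S, S + c, …, S + (h - 1) c` of a set `S` of the
class `P`. -/
def IsColumn (P : Set ℤ → Prop) (c h : ℕ) (A : Set ℤ) : Prop :=
  ∃ S, P S ∧ Set.InjOn (fun p : ℤ × ℕ => p.1 + c * p.2) {p | p.1 ∈ S ∧ p.2 < h} ∧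
    A = (fun p : ℤ × ℕ => p.1 + c * p.2) '' {p | p.1 ∈ S ∧ p.2 < h}

theorem TranslationInvariant.isColumn {P : Set ℤ → Prop} (hP : TranslationInvariant P) (c h : ℕ) :
    TranslationInvariant (IsColumn P c h) := by
  rintro _ a ⟨S, hS, hinj, rfl⟩
  refine ⟨_, hP S a hS, ?_, ?_⟩
  · rintro ⟨_, y⟩ ⟨⟨s, hs, rfl⟩, hy⟩ ⟨_, y'⟩ ⟨⟨s', hs', rfl⟩, hy'⟩ heq
    have := @hinj (s, y) ⟨hs, hy⟩ (s', y') ⟨hs', hy'⟩ (by simp only at heq ⊢; linarith)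
    simp only [Prod.mk.injEq] at this
    simp [this]
  · ext x
    simp only [Set.mem_image, Prod.exists, Set.mem_ofPred_eq]
    constructor
    · rintro ⟨_, ⟨s, y, ⟨hs, hy⟩, rfl⟩, rfl⟩
      exact ⟨s + a, y, ⟨⟨s, hs, rfl⟩, hy⟩, by ring⟩
    · rintro ⟨_, y, ⟨⟨s, hs, rfl⟩, hy⟩, rfl⟩
      exact ⟨s + c * y, ⟨s, y, ⟨hs, hy⟩, rfl⟩, by ring⟩

/-- The residues in `[a, b)` contribute columns of height `h` to the interval `[0, L)`. -/
theorem Tiled.isColumn {P : Set ℤ → Prop} {a b : ℤ} {c h : ℕ} (hab : Tiled P (Set.Ico a b))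
    (hc : 0 < c) (ha : 0 ≤ a) (hb : b ≤ c) {L : ℤ}
    (hL : ∀ s : ℤ, a ≤ s → s < b → ∀ y : ℕ, s + c * y < L ↔ y < h) :
    Tiled (IsColumn P c h) {x | x % (c : ℤ) ∈ Set.Ico a b ∧ x ∈ Set.Ico 0 L} := by
  refine hab.preimage (fun x : ℤ => x % (c : ℤ)) (Set.Ico 0 L) fun A hA hAS => ?_
  have hc' : (0 : ℤ) < c := by exact_mod_cast hc
  refine Tiled.of ⟨A, hA, ?_, ?_⟩
  · rintro ⟨s, y⟩ ⟨hs, -⟩ ⟨s', y'⟩ ⟨hs', -⟩ heq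
    have h1 := hAS hs
    have h2 := hAS hs'
    simp only [Set.mem_Ico] at h1 h2 heq
    have e1 : s = (s + c * y) % c := by
      rw [Int.add_mul_emod_self_left, Int.emod_eq_of_lt (by omega) (by omega)]
    have e2 : s' = (s' + c * y') % c := by
      rw [Int.add_mul_emod_self_left, Int.emod_eq_of_lt (by omega) (by omega)]
    have e3 : s = s' := by rw [e1, e2, heq]
    subst e3
    have e4 : (c : ℤ) * y = c * y' := by linarith
    have e5 := mul_left_cancel₀ hc'.ne' e4
    simpa using e5
  · ext x
    simp only [Set.mem_ofPred_eq, Set.mem_image, Prod.exists, Set.mem_Ico]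
    constructor
    · rintro ⟨hx, hx0, hxL⟩
      have h1 := hAS hx
      have h2 := Int.emod_add_mul_ediv x c
      have h3 : 0 ≤ x / c := Int.ediv_nonneg hx0 hc'.le
      refine ⟨x % c, (x / c).toNat, ⟨hx, ?_⟩, ?_⟩
      · rw [← hL _ h1.1 h1.2, Int.toNat_of_nonneg h3, h2]; exact hxL
      · rw [Int.toNat_of_nonneg h3, h2]
    · rintro ⟨s, y, ⟨hs, hy⟩, rfl⟩
      have h1 := hAS hs
      rw [← hL _ h1.1 h1.2] at hy
      simp only [Set.mem_Ico] at h1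
      refine ⟨?_, ?_, hy⟩
      · rw [Int.add_mul_emod_self_left, Int.emod_eq_of_lt (by omega) (by omega)]; exact hs
      · have := mul_nonneg hc'.le (Int.natCast_nonneg y)
        omega

/-- The interval `[0, h c + j)` has columns of height `h + 1` over the residues below `j`, and of
height `h` over the others. -/
theorem tiled_isColumn {P : Set ℤ → Prop} (hP : TranslationInvariant P) {c j : ℕ} (hc : 0 < c)
    (hjc : j ≤ c) (h1 : Tiled P (Set.Ico 0 (j : ℤ))) (h2 : Tiled P (Set.Ico 0 ((c - j : ℕ) : ℤ)))
    (h : ℕ) :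
    Tiled (fun A => ∃ h', h ≤ h' ∧ IsColumn P c h' A) (Set.Ico 0 ((h * c + j : ℕ) : ℤ)) := by
  have hc' : (0 : ℤ) < c := by exact_mod_cast hc
  have hlt : ∀ (s : ℤ) (y k : ℕ) (d : ℤ), 0 ≤ s → s < c → 0 ≤ d → d ≤ c →
      (s + c * y < k * c + d ↔ (y < k ∨ y = k ∧ s < d)) := by
    intro s y k d hs hsc hd hdc
    constructor
    · intro hlt
      rcases lt_trichotomy y k with h | h | h
      · exact Or.inl h
      · subst h; exact Or.inr ⟨rfl, by linarith⟩
      · have : ((k : ℤ) + 1) * c ≤ y * c := mul_le_mul_of_nonneg_right (by exact_mod_cast h) hc'.le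
        linarith
    · rintro (h | ⟨rfl, h⟩)
      · have : ((y : ℤ) + 1) * c ≤ k * c := mul_le_mul_of_nonneg_right (by exact_mod_cast h) hc'.le
        linarith
      · linarith
  have e1 := h1.isColumn (h := h + 1) (L := ((h * c + j : ℕ) : ℤ)) hc le_rfl (by exact_mod_cast hjc)
    fun s hs hsj y => by
      push_cast
      rw [hlt s y h j hs (by omega) (by omega) (by omega)]
      omega
  have h2' := h2.translate hP j
  rw [zero_add, show ((c - j : ℕ) : ℤ) + j = c by omega] at h2'
  have e2 := h2'.isColumn (h := h) (L := ((h * c + j : ℕ) : ℤ)) hc (by omega) le_rfl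
    fun s hs hsj y => by
      push_cast
      rw [hlt s y h j (by omega) (by omega) (by omega) (by omega)]
      omega
  refine Tiled.split (fun x : ℤ => x % c < j) ?_ ?_
  · convert e1.mono (P' := fun A => ∃ h', h ≤ h' ∧ IsColumn P c h' A)
      fun A hA => ⟨h + 1, by omega, hA⟩ using 1
    ext x
    have := Int.emod_nonneg x hc'.ne'
    simp only [Set.mem_ofPred_eq, Set.mem_Ico]; tauto
  · convert e2.mono (P' := fun A => ∃ h', h ≤ h' ∧ IsColumn P c h' A)
      fun A hA => ⟨h, by omega, hA⟩ using 1
    ext x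
    have := Int.emod_lt_of_pos x hc'
    simp only [Set.mem_ofPred_eq, Set.mem_Ico, not_lt]; tauto

/-- The lengths `h c + j` and `h c + j + 1` are coprime, so that all long intervals can be
decomposed into high columns. -/
theorem SplitsTwice.tilesLong {P : Set ℤ → Prop} (hP : TranslationInvariant P) {c : ℕ}
    (h : SplitsTwice P c) (H : ℕ) : TilesLong (fun A => ∃ h, H ≤ h ∧ IsColumn P c h A) := by
  obtain ⟨j, hj, h1, h2, h3, h4⟩ := h
  have hinv : TranslationInvariant (fun A => ∃ h, H ≤ h ∧ IsColumn P c h A) := by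
    rintro A a ⟨h, hh, hA⟩
    exact ⟨h, hh, hP.isColumn c h A a hA⟩
  have e1 := (tiled_isColumn hP (by omega) (by omega) h1 h3 (H + 1)).mono
    (P' := fun A => ∃ h, H ≤ h ∧ IsColumn P c h A)
    fun A ⟨h, hh, hA⟩ => ⟨h, by omega, hA⟩
  have e2 := (tiled_isColumn hP (by omega) hj h2 h4 (H + 1)).mono
    (P' := fun A => ∃ h, H ≤ h ∧ IsColumn P c h A)
    fun A ⟨h, hh, hA⟩ => ⟨h, by omega, hA⟩
  refine tilesLong_of_succ hinv (n := (H + 1) * c + j) ?_ e1 e2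
  have : 0 < (H + 1) * c := Nat.mul_pos (by omega) (by omega)
  omega

/-- A column over a window of `T` is a rectangle in the coordinates given by the window and by the
height; a partition of the rectangle into lattice paths decomposes it into windows for the gap set
that also contains `m` copies of `c`. -/
theorem IsColumn.tiled {T : Multiset ℤ} {c h m ρ : ℕ} {A : Set ℤ}
    (hA : IsColumn (IsWindow T 1 id) c h A) (hc : 0 < c) (hm : 0 < m) (hρ : ρ ≤ 1)
    (hrect : ∀ r ≤ 1, Tiled (IsPath (Multiset.card T) m ρ)
      {p | p.1 < Multiset.card T + 1 + r ∧ p.2 < h}) :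
    Tiled (IsWindow (T + Multiset.replicate m (c : ℤ)) ρ id) A := by
  obtain ⟨S, ⟨r, hr, u, hu, e, rfl, he⟩, hinj, rfl⟩ := hA
  simp only [id] at he
  have hEA : (fun p : ℤ × ℕ => p.1 + c * p.2) ''
      {p | p.1 ∈ e '' Set.Iio (Multiset.card T + 1 + r) ∧ p.2 < h} =
      (fun p : ℕ × ℕ => u p.1 + c * p.2) '' {p | p.1 < Multiset.card T + 1 + r ∧ p.2 < h} := by
    ext x
    simp only [Set.mem_image, Prod.exists, Set.mem_ofPred_eq, Set.mem_Iio]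
    constructor
    · rintro ⟨_, y, ⟨⟨i, hi, rfl⟩, hy⟩, rfl⟩
      exact ⟨i, y, ⟨hi, hy⟩, by rw [he i hi]⟩
    · rintro ⟨i, y, ⟨hi, hy⟩, rfl⟩
      exact ⟨_, y, ⟨⟨i, hi, rfl⟩, hy⟩, by rw [he i hi]⟩
  rw [hEA]
  refine (hrect r hr).image _ ?_ ?_
  · rintro ⟨i, y⟩ ⟨hi, hy⟩ ⟨i', y'⟩ ⟨hi', hy'⟩ heq
    simp only at hi hi' hy hy' heq
    have := @hinj (u i, y) ⟨⟨i, hi, he i hi⟩, hy⟩ (u i', y') ⟨⟨i', hi', he i' hi'⟩, hy'⟩ heq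
    simp only [Prod.mk.injEq] at this
    simp [hu.strictMono.injective this.1, this.2]
  · intro B hB _
    refine IsPath.isWindow (V := Multiset.replicate m (c : ℤ)) (by simpa using hB) hρ (by simpa)
      hu (isGapSeq_replicate m (by exact_mod_cast hc) 0) _ _ fun p _ => by simp

/-- Adding `m ≥ 2` copies of one further gap length. The bound on `m` is needed for the rectangles
over the longer windows of `T`. -/
theorem SplitsTwice.tilesLong_isWindow {T : Multiset ℤ} {c m : ℕ} (hT : 0 < Multiset.card T)
    (h : SplitsTwice (IsWindow T 1 id) c) (hm : 2 ≤ m) :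
    TilesLong (IsWindow (T + Multiset.replicate m (c : ℤ)) 1 id) := by
  obtain ⟨H₀, hH₀⟩ := exists_tiled_rect (r := 0) (t := Multiset.card T) (m := m) (by omega) hT
    (by omega)
  obtain ⟨H₁, hH₁⟩ := exists_tiled_rect (r := 1) (t := Multiset.card T) (m := m) (by omega) hT
    (by omega)
  obtain ⟨L₀, hL⟩ := h.tilesLong (translationInvariant_isWindow T 1) (max H₀ H₁)
  refine ⟨L₀, fun L hLL => (hL L hLL).bind ?_⟩
  rintro A ⟨h', hh, hA⟩ -
  obtain ⟨_, hj, -⟩ := h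
  refine hA.tiled (by omega) (by omega) le_rfl fun r hr => ?_
  rcases Nat.le_one_iff_eq_zero_or_eq_one.1 hr with rfl | rfl
  · exact hH₀ h' (by omega)
  · exact hH₁ h' (by omega)

/-- Columns of height `2 (card T + m + 1)` over all residues modulo `c` are tiled by windows of
minimal length, that is, by tiles. -/
theorem tiled_exact {T : Multiset ℤ} {c m : ℕ} (hm : 0 < m) (hc : 0 < c)
    (h : Tiled (IsWindow T 1 id) (Set.Ico 0 (c : ℤ))) :
    ∃ L : ℕ, 0 < L ∧
      Tiled (IsWindow (T + Multiset.replicate m (c : ℤ)) 0 id) (Set.Ico 0 (L : ℤ)) := by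
  have hc' : (0 : ℤ) < c := by exact_mod_cast hc
  have hpos : 0 < 2 * (Multiset.card T + m + 1) := by omega
  refine ⟨2 * (Multiset.card T + m + 1) * c, Nat.mul_pos hpos hc, ?_⟩
  have h1 := h.isColumn (h := 2 * (Multiset.card T + m + 1))
    (L := ((2 * (Multiset.card T + m + 1) * c : ℕ) : ℤ)) hc le_rfl le_rfl fun s hs hsc y => by
      rw [← Nat.cast_lt (α := ℤ)]
      generalize 2 * (Multiset.card T + m + 1) = k
      push_cast
      constructor
      · intro hlt
        by_contra! hle
        have := mul_le_mul_of_nonneg_right hle hc'.le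
        linarith
      · intro hlt
        have : ((y : ℤ) + 1) * c ≤ k * c := mul_le_mul_of_nonneg_right (by omega) hc'.le
        linarith
  have h2 := h1.bind fun A hA _ => hA.tiled hc hm zero_le_one fun r hr =>
    tiled_rect_exact hr hm even_two
  convert h2 using 1
  ext x
  have := Int.emod_nonneg x hc'.ne'
  have := Int.emod_lt_of_pos x hc'
  simp only [Set.mem_Ico, Set.mem_ofPred_eq]; tauto

/-! ### Adding two gap lengths at once -/

/-- The region `S` of the plane is good if, for all `c₁`, `c₂`, every product of a window of `T`
with `S` is tiled by windows of the gap set with `m₁` copies of `c₁` and `m₂` copies of `c₂` added,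
in the weight `u x + c₁ y + c₂ z`. -/
def Good (T : Multiset ℤ) (m₁ m₂ : ℕ) (S : Set (ℕ × ℕ)) : Prop :=
  ∀ c₁ c₂ : ℕ, 0 < c₁ → 0 < c₂ → ∀ u, IsGapSeq T u → ∀ r ≤ 1,
    Tiled (IsWindow (T + Multiset.replicate m₁ (c₁ : ℤ) + Multiset.replicate m₂ (c₂ : ℤ)) 1
      (fun p : ℕ × ℕ × ℕ => u p.1 + (c₁ * p.2.1 + c₂ * p.2.2)))
      {p | p.1 < Multiset.card T + 1 + r ∧ p.2 ∈ S}

namespace Good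

variable {T : Multiset ℤ} {m₁ m₂ : ℕ} {S S' : Set (ℕ × ℕ)}

theorem empty : Good T m₁ m₂ ∅ := fun c₁ c₂ _ _ u _ r _ => by
  simpa using Tiled.empty

theorem split (p : ℕ × ℕ → Prop) (h : Good T m₁ m₂ {x | x ∈ S ∧ p x})
    (h' : Good T m₁ m₂ {x | x ∈ S ∧ ¬ p x}) : Good T m₁ m₂ S := fun c₁ c₂ h1 h2 u hu r hr => by
  refine Tiled.split (fun x => p x.2) ?_ ?_
  · convert h c₁ c₂ h1 h2 u hu r hr using 1
    ext x; simp only [Set.mem_ofPred_eq]; tauto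
  · convert h' c₁ c₂ h1 h2 u hu r hr using 1
    ext x; simp only [Set.mem_ofPred_eq]; tauto

theorem translate (h : Good T m₁ m₂ S) (b₁ b₂ : ℕ)
    (hS : ∀ y z, (y, z) ∈ S' ↔ b₁ ≤ y ∧ b₂ ≤ z ∧ (y - b₁, z - b₂) ∈ S) : Good T m₁ m₂ S' := by
  intro c₁ c₂ h1 h2 u hu r hr
  have := (h c₁ c₂ h1 h2 u hu r hr).image (Q := IsWindow (T + Multiset.replicate m₁ (c₁ : ℤ) +
      Multiset.replicate m₂ (c₂ : ℤ)) 1 (fun p : ℕ × ℕ × ℕ => u p.1 + (c₁ * p.2.1 + c₂ * p.2.2)))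
    (· + (0, b₁, b₂)) (add_left_injective _).injOn
    fun A hA _ => hA.image _ (c₁ * b₁ + c₂ * b₂) fun x _ => by
      simp only [Prod.fst_add, Prod.snd_add, add_zero]; push_cast; ring
  convert this using 1
  ext ⟨x, y, z⟩
  simp only [Set.mem_ofPred_eq, hS, Set.mem_image, Prod.exists, Prod.mk_add_mk, Prod.mk.injEq,
    add_zero]
  constructor
  · rintro ⟨hx, hy, hz, h⟩
    exact ⟨x, _, _, ⟨hx, h⟩, rfl, by omega, by omega⟩
  · rintro ⟨x', y', z', ⟨hx, h⟩, rfl, rfl, rfl⟩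
    exact ⟨hx, by omega, by omega, by simpa using h⟩

theorem congr (h : Good T m₁ m₂ S) (hS : ∀ y z, (y, z) ∈ S' ↔ (y, z) ∈ S) : Good T m₁ m₂ S' :=
  h.translate 0 0 fun y z => by simpa using hS y z

theorem swap (h : Good T m₂ m₁ S) : Good T m₁ m₂ {p | p.swap ∈ S} := by
  intro c₁ c₂ h1 h2 u hu r hr
  have := (h c₂ c₁ h2 h1 u hu r hr).image (Q := IsWindow (T + Multiset.replicate m₁ (c₁ : ℤ) +
      Multiset.replicate m₂ (c₂ : ℤ)) 1 (fun p : ℕ × ℕ × ℕ => u p.1 + (c₁ * p.2.1 + c₂ * p.2.2)))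
    (fun p => (p.1, p.2.swap)) (fun p _ q _ hpq => by
      simp only [Prod.mk.injEq] at hpq
      exact Prod.ext hpq.1 (Prod.swap_injective hpq.2))
    fun A hA _ => by
      rw [add_right_comm] at hA
      exact hA.image _ 0 fun x _ => by simp; ring
  convert this using 1
  ext ⟨x, y, z⟩
  simp only [Set.mem_ofPred_eq, Set.mem_image, Prod.exists, Prod.swap_prod_mk, Prod.mk.injEq]
  constructor
  · rintro ⟨hx, h⟩
    exact ⟨x, z, y, ⟨hx, h⟩, rfl, rfl, rfl⟩
  · rintro ⟨x', y', z', ⟨hx, h⟩, rfl, rfl, rfl⟩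
    exact ⟨hx, h⟩

end Good

theorem path_fst_add_snd {e : ℕ → ℕ × ℕ} {L : ℕ}
    (he : ∀ i < L, e (i + 1) = e i + (1, 0) ∨ e (i + 1) = e i + (0, 1)) :
    ∀ i ≤ L, (e i).1 + (e i).2 = (e 0).1 + (e 0).2 + i := by
  intro i
  induction i with
  | zero => simp
  | succ i ih =>
    intro hi
    have := ih (by omega)
    rcases he i (by omega) with h | h <;> rw [h] <;>
      simp only [Prod.fst_add, Prod.snd_add] <;> omega

theorem path_snd_mono {e : ℕ → ℕ × ℕ} {L : ℕ}
    (he : ∀ i < L, e (i + 1) = e i + (1, 0) ∨ e (i + 1) = e i + (0, 1)) {i j : ℕ} (hij : i ≤ j)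
    (hj : j ≤ L) : (e i).2 ≤ (e j).2 := by
  induction j, hij using Nat.le_induction with
  | base => exact le_rfl
  | succ j _ ih =>
    refine (ih (by omega)).trans ?_
    rcases he j (by omega) with h | h <;> rw [h] <;> simp

/-- To see that `S` is good, take tiles of `T` and `m₁` copies of `c₁` for the rows, and fill the
part of the plane above each of them. -/
theorem good_of_path {T : Multiset ℤ} {m₁ m₂ l : ℕ} {S : Set (ℕ × ℕ)} (hm₁ : 0 < m₁)
    (hm₂ : 0 < m₂) (hl : Even l) (hS : ∀ y z, (y, z) ∈ S → y < l * (Multiset.card T + m₁ + 1))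
    (h : ∀ e : ℕ → ℕ × ℕ, (∀ i < Multiset.card T + m₁,
        e (i + 1) = e i + (1, 0) ∨ e (i + 1) = e i + (0, 1)) →
      (e (Multiset.card T + m₁)).2 = (e 0).2 + m₁ →
      (∀ i < Multiset.card T + m₁ + 1, (e i).2 < l * (Multiset.card T + m₁ + 1)) →
      Tiled (IsPath (Multiset.card T + m₁) m₂ 1)
        {q | q.1 < Multiset.card T + m₁ + 1 ∧ ((e q.1).2, q.2) ∈ S}) : Good T m₁ m₂ S := by
  intro c₁ c₂ h1 h2 u hu r hr
  have key := (tiled_rect_exact (t := Multiset.card T) hr hm₁ hl).preimage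
    (Q := IsWindow (T + Multiset.replicate m₁ (c₁ : ℤ) +
      Multiset.replicate m₂ (c₂ : ℤ)) 1 (fun p : ℕ × ℕ × ℕ => u p.1 + (c₁ * p.2.1 + c₂ * p.2.2)))
    (fun p : ℕ × ℕ × ℕ => (p.1, p.2.1)) {p | p.2 ∈ S} ?_
  · convert key using 1
    ext ⟨x, y, z⟩
    simp only [Set.mem_ofPred_eq]
    constructor
    · rintro ⟨hx, hyz⟩; exact ⟨⟨hx, hS y z hyz⟩, hyz⟩
    · rintro ⟨⟨hx, -⟩, hyz⟩; exact ⟨hx, hyz⟩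
  · rintro B ⟨r', hr', e, he, hend, hr1, rfl⟩ hBS
    obtain rfl : r' = 0 := by omega
    have hinj : ∀ i < Multiset.card T + m₁ + 1, ∀ j < Multiset.card T + m₁ + 1,
        e i = e j → i = j := fun i hi j hj hij => by
      have hi' := path_fst_add_snd he i (by omega)
      have hj' := path_fst_add_snd he j (by omega)
      rw [hij] at hi'; omega
    obtain ⟨c, hc, hce⟩ := exists_isGapSeq_path (r := 0) (V := Multiset.replicate m₁ (c₁ : ℤ))
      (by omega) (by simpa) hu (isGapSeq_replicate m₁ (by exact_mod_cast h1) 0) e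
      (by simpa using he) (by simpa using hend) (by simp)
    simp only [Multiset.card_replicate, add_zero] at hce
    have h' := (h e he (by simpa using congrArg Prod.snd hend) (fun i hi => by
      exact (hBS ⟨i, hi, rfl⟩).2)).image (Q := IsWindow (T + Multiset.replicate m₁ (c₁ : ℤ) +
      Multiset.replicate m₂ (c₂ : ℤ)) 1 (fun p : ℕ × ℕ × ℕ => u p.1 + (c₁ * p.2.1 + c₂ * p.2.2)))
      (fun q => ((e q.1).1, (e q.1).2, q.2)) ?_ ?_
    · convert h' using 1
      ext ⟨x, y, z⟩
      simp only [Set.mem_ofPred_eq, Set.mem_image, Set.mem_Iio, Prod.exists, Prod.mk.injEq]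
      constructor
      · rintro ⟨⟨i, hi, hxy⟩, hyz⟩
        refine ⟨i, z, ⟨by omega, ?_⟩, ?_⟩
        · rw [hxy]; exact hyz
        · rw [hxy]; exact ⟨rfl, rfl, rfl⟩
      · rintro ⟨i, z', ⟨hi, hyz⟩, rfl, rfl, rfl⟩
        exact ⟨⟨i, by omega, rfl⟩, hyz⟩
    · rintro ⟨i, z⟩ ⟨hi, -⟩ ⟨j, z'⟩ ⟨hj, -⟩ hij
      simp only [Prod.mk.injEq] at hij hi hj ⊢
      exact ⟨hinj i hi j hj (Prod.ext hij.1 hij.2.1), hij.2.2⟩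
    · intro B hB hBS'
      refine IsPath.isWindow (T := T + Multiset.replicate m₁ (c₁ : ℤ))
        (V := Multiset.replicate m₂ (c₂ : ℤ)) (by simpa using hB) le_rfl (by simpa) hc
        (isGapSeq_replicate m₂ (by exact_mod_cast h2) 0) _ _ fun p hp => ?_
      have := hce p.1 (hBS' hp).1
      simp only at this ⊢
      linarith

/-- Both parts into which the staircase `z = b + m₂ ⌊y / m₁⌋` cuts a strip are good. -/
theorem exists_good_stairs (T : Multiset ℤ) {m₁ m₂ : ℕ} (hm₁ : 0 < m₁) (hm₂ : 0 < m₂) :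
    ∃ H, ∀ l b, Even l → H ≤ b →
      Good T m₁ m₂ {p | p.1 < l * (Multiset.card T + m₁ + 1) ∧ p.2 < b} ∧
      Good T m₁ m₂ {p | p.1 < l * (Multiset.card T + m₁ + 1) ∧ p.2 < b + m₂ * (p.1 / m₁)} ∧
      ∀ K, (∀ y < l * (Multiset.card T + m₁ + 1), b + m₂ * (y / m₁) + H ≤ K) →
        Good T m₁ m₂ {p | p.1 < l * (Multiset.card T + m₁ + 1) ∧ b + m₂ * (p.1 / m₁) ≤ p.2 ∧
          p.2 < K} := by
  obtain ⟨H₁, h₁⟩ := exists_tiled_rect (r := 0) (t := Multiset.card T + m₁) (m := m₂) (by omega)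
    (by omega) (by omega)
  obtain ⟨H₂, h₂⟩ := exists_tiled_step (t := Multiset.card T + m₁) (m := m₂) (by omega) hm₂
  have hstep : ∀ e : ℕ → ℕ × ℕ, (∀ i < Multiset.card T + m₁,
        e (i + 1) = e i + (1, 0) ∨ e (i + 1) = e i + (0, 1)) →
      (e (Multiset.card T + m₁)).2 = (e 0).2 + m₁ →
      ∃ p ≤ Multiset.card T + m₁ + 1, ∀ i < Multiset.card T + m₁ + 1,
        m₂ * ((e i).2 / m₁) = m₂ * ((e 0).2 / m₁) + if p ≤ i then m₂ else 0 := by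
    -- Along a tile, `y` grows by exactly `m₁`, so it passes exactly one multiple of `m₁`.
    intro e he hend
    have hlast : (e (Multiset.card T + m₁)).2 / m₁ = (e 0).2 / m₁ + 1 := by
      rw [hend, Nat.add_div_right _ hm₁]
    have hex : ∃ i, (e 0).2 / m₁ + 1 ≤ (e i).2 / m₁ := ⟨_, hlast.ge⟩
    classical
    refine ⟨Nat.find hex, (Nat.find_min' hex hlast.ge).trans (by omega), fun i hi => ?_⟩
    have hl : (e 0).2 / m₁ ≤ (e i).2 / m₁ :=
      Nat.div_le_div_right (path_snd_mono he (Nat.zero_le i) (by omega))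
    have hu : (e i).2 / m₁ ≤ (e (Multiset.card T + m₁)).2 / m₁ :=
      Nat.div_le_div_right (path_snd_mono he (by omega) le_rfl)
    split_ifs with h
    · have h3 : (e (Nat.find hex)).2 / m₁ ≤ (e i).2 / m₁ :=
        Nat.div_le_div_right (path_snd_mono he h (by omega))
      have h4 := Nat.find_spec hex
      have : (e i).2 / m₁ = (e 0).2 / m₁ + 1 := by omega
      rw [this]; ring
    · have h3 := Nat.find_min hex (not_le.1 h)
      have : (e i).2 / m₁ = (e 0).2 / m₁ := by omega
      rw [this, add_zero]
  refine ⟨H₁ + H₂, fun l b hl hb => ⟨?_, ?_, fun K hK => ?_⟩⟩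
  · refine good_of_path hm₁ hm₂ hl (fun y z h => h.1) fun e he hend hle => ?_
    convert h₁ b (by omega) using 1
    ext q
    simp only [Set.mem_ofPred_eq, add_zero]
    exact and_congr_right fun hq => and_iff_right (hle _ hq)
  · refine good_of_path hm₁ hm₂ hl (fun y z h => h.1) fun e he hend hle => ?_
    obtain ⟨p, hp, hpe⟩ := hstep e he hend
    convert (h₂ p (b + m₂ * ((e 0).2 / m₁)) hp (by omega)).1 using 1
    ext q
    simp only [Set.mem_ofPred_eq]
    refine and_congr_right fun hq => ?_
    rw [and_iff_right (hle _ hq), hpe _ hq, add_assoc]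
  · refine good_of_path hm₁ hm₂ hl (fun y z h => h.1) fun e he hend hle => ?_
    obtain ⟨p, hp, hpe⟩ := hstep e he hend
    have h0 := hK _ (hle 0 (by omega))
    convert (h₂ p (b + m₂ * ((e 0).2 / m₁)) hp (by omega)).2 K (by omega) using 1
    ext q
    simp only [Set.mem_ofPred_eq]
    refine and_congr_right fun hq => ?_
    rw [and_iff_right (hle _ hq), hpe _ hq, add_assoc]

/-- The horizontal position after `i` steps along the staircase which takes `m₁` steps to the right
and `m₂` steps upwards in turn. -/
def stairX (m₁ m₂ i : ℕ) : ℕ := m₁ * (i / (m₁ + m₂)) + min (i % (m₁ + m₂)) m₁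

/-- The vertical position after `i` steps along the staircase of `stairX`. -/
def stairY (m₁ m₂ i : ℕ) : ℕ := m₂ * (i / (m₁ + m₂)) + (i % (m₁ + m₂) - m₁)

theorem stairX_add_stairY (m₁ m₂ i : ℕ) : stairX m₁ m₂ i + stairY m₁ m₂ i = i := by
  have := Nat.div_add_mod i (m₁ + m₂)
  rw [add_mul] at this
  simp only [stairX, stairY]
  omega

theorem stair_succ {m₁ m₂ : ℕ} (hm₂ : 0 < m₂) (i : ℕ) :
    (i % (m₁ + m₂) < m₁ ∧ stairX m₁ m₂ (i + 1) = stairX m₁ m₂ i + 1 ∧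
      stairY m₁ m₂ (i + 1) = stairY m₁ m₂ i) ∨
    (m₁ ≤ i % (m₁ + m₂) ∧ stairX m₁ m₂ (i + 1) = stairX m₁ m₂ i ∧
      stairY m₁ m₂ (i + 1) = stairY m₁ m₂ i + 1) := by
  simp only [stairX, stairY]
  rcases succ_div_mod (W := m₁ + m₂) (i := i) (by omega) with ⟨h, h1, h2⟩ | ⟨h, h1, h2⟩
  · rw [h1, h2]; omega
  · rw [h1, h2, mul_add, mul_add]; omega

theorem isGapSeq_stair {m₁ m₂ c₁ c₂ : ℕ} (hm₂ : 0 < m₂) (h1 : 0 < c₁) (h2 : 0 < c₂) :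
    IsGapSeq (Multiset.replicate m₁ (c₁ : ℤ) + Multiset.replicate m₂ (c₂ : ℤ))
      (fun i => (c₁ * stairX m₁ m₂ i + c₂ * stairY m₁ m₂ i : ℤ)) := by
  have hgap : ∀ i, (c₁ * stairX m₁ m₂ (i + 1) + c₂ * stairY m₁ m₂ (i + 1) : ℤ) -
      (c₁ * stairX m₁ m₂ i + c₂ * stairY m₁ m₂ i) =
      if i % (m₁ + m₂) < m₁ then (c₁ : ℤ) else c₂ := by
    intro i
    rcases stair_succ (m₁ := m₁) hm₂ i with ⟨h, h1, h2⟩ | ⟨h, h1, h2⟩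
    · rw [if_pos h, h1, h2]; push_cast; ring
    · rw [if_neg (by omega), h1, h2]; push_cast; ring
  refine ⟨strictMono_nat_of_lt_succ fun i => ?_, fun i => ?_, ?_⟩
  · have := hgap i
    split_ifs at this <;> omega
  · rw [hgap, hgap]; simp
  · simp only [hgap, Multiset.card_add, Multiset.card_replicate]
    have : ∀ n ≤ m₂, (Multiset.range (m₁ + n)).map
        (fun i => if i % (m₁ + m₂) < m₁ then (c₁ : ℤ) else c₂) =
        Multiset.replicate m₁ (c₁ : ℤ) + Multiset.replicate n (c₂ : ℤ) := by
      intro n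
      induction n with
      | zero =>
        intro _
        rw [add_zero, Multiset.replicate_zero, add_zero, Multiset.eq_replicate]
        refine ⟨by simp, fun b hb => ?_⟩
        obtain ⟨i, hi, rfl⟩ := Multiset.mem_map.1 hb
        rw [Multiset.mem_range] at hi
        rw [if_pos (by rw [Nat.mod_eq_of_lt (by omega)]; exact hi)]
      | succ n ih =>
        intro hn
        rw [← add_assoc, Multiset.range_succ, Multiset.map_cons, ih (by omega),
          if_neg (by rw [Nat.mod_eq_of_lt (by omega)]; omega), Multiset.replicate_succ,
          Multiset.add_cons]
    exact this m₂ le_rfl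

/-- The points of the first `Q` rounds of the staircase, described column by column. In column `0`
the truncated subtraction gives the lower bound `0`, as it should. -/
theorem mem_stair_iff {m₁ m₂ Q y z : ℕ} (hm₁ : 0 < m₁) (hm₂ : 0 < m₂) (hQ : 0 < Q) :
    (∃ i ≤ Q * (m₁ + m₂), stairX m₁ m₂ i = y ∧ stairY m₁ m₂ i = z) ↔
      y ≤ Q * m₁ ∧ m₂ * ((y - 1) / m₁) ≤ z ∧ z ≤ m₂ * (y / m₁) := by
  constructor
  · rintro ⟨i, hi, rfl, rfl⟩
    have hd := Nat.div_add_mod i (m₁ + m₂)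
    have hlt := Nat.mod_lt i (show 0 < m₁ + m₂ by omega)
    simp only [stairX, stairY]
    generalize i % (m₁ + m₂) = ρ at *
    generalize i / (m₁ + m₂) = q at *
    have hq : q < Q ∨ q = Q ∧ ρ = 0 := by
      rcases lt_trichotomy q Q with h | rfl | h
      · exact Or.inl h
      · rw [mul_comm] at hd; exact Or.inr ⟨rfl, by omega⟩
      · have := Nat.mul_le_mul_left (m₁ + m₂) (Nat.succ_le_of_lt h)
        rw [mul_comm Q] at hi
        rw [Nat.mul_succ] at this; omega
    have hY : m₁ * q + min ρ m₁ ≤ Q * m₁ := by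
      rcases hq with hq | ⟨rfl, rfl⟩
      · have := Nat.mul_le_mul_left m₁ (Nat.succ_le_of_lt hq)
        rw [Nat.mul_succ, mul_comm m₁ Q] at this
        omega
      · simp [mul_comm]
    have hdiv : ∀ k s, s < m₁ → (m₁ * k + s) / m₁ = k := fun k s hs => by
      rw [Nat.mul_add_div hm₁, Nat.div_eq_of_lt hs, add_zero]
    refine ⟨hY, ?_, ?_⟩
    · have h1 : (m₁ * q + min ρ m₁ - 1) / m₁ ≤ q := by
        refine Nat.lt_succ_iff.1 ((Nat.div_lt_iff_lt_mul hm₁).2 ?_)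
        rw [Nat.succ_mul, mul_comm q]; omega
      exact (Nat.mul_le_mul_left m₂ h1).trans (Nat.le_add_right _ _)
    · rcases Nat.lt_or_ge ρ m₁ with h | h
      · rw [min_eq_left h.le, hdiv _ _ h]; omega
      · rw [min_eq_right h]
        have := hdiv (q + 1) 0 hm₁
        rw [add_zero, mul_add, mul_one] at this
        rw [this, mul_add]; omega
  · rintro ⟨hy, hz1, hz2⟩
    have hle : y + z ≤ Q * (m₁ + m₂) := by
      have h1 : y / m₁ ≤ Q := Nat.div_le_of_le_mul (by rw [mul_comm]; exact hy)
      have h2 := Nat.mul_le_mul_left m₂ h1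
      rw [mul_add, mul_comm Q m₂]; omega
    have key : ∀ q ρ, ρ < m₁ + m₂ → y + z = (m₁ + m₂) * q + ρ → y = m₁ * q + min ρ m₁ →
        stairX m₁ m₂ (y + z) = y := by
      intro q ρ hρ h h'
      rw [stairX, h, Nat.mul_add_div (by omega), Nat.div_eq_of_lt hρ, Nat.mul_add_mod,
        Nat.mod_eq_of_lt hρ, h', add_zero]
    suffices hX : stairX m₁ m₂ (y + z) = y by
      have := stairX_add_stairY m₁ m₂ (y + z)
      exact ⟨y + z, hle, hX, by omega⟩
    rcases Nat.eq_zero_or_pos y with rfl | hy0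
    · simp only [Nat.zero_div, mul_zero] at hz2
      exact key 0 0 (by omega) (by omega) (by simp)
    · have hd := Nat.div_add_mod (y - 1) m₁
      have hlt := Nat.mod_lt (y - 1) hm₁
      generalize (y - 1) / m₁ = q at *
      generalize (y - 1) % m₁ = s at *
      obtain rfl : y = m₁ * q + (s + 1) := by omega
      rcases Nat.lt_or_ge (s + 1) m₁ with h | h
      · rw [Nat.mul_add_div hm₁, Nat.div_eq_of_lt h, add_zero] at hz2
        refine key q (s + 1) (by omega) (by rw [add_mul]; omega) (by rw [min_eq_left h.le])
      · have hs : s + 1 = m₁ := by omega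
        rw [hs] at key hz2 ⊢
        rw [Nat.mul_add_div hm₁, Nat.div_self hm₁, mul_add] at hz2
        rcases Nat.lt_or_ge (z - m₂ * q) m₂ with h3 | h3
        · exact key q (m₁ + (z - m₂ * q)) (by omega) (by rw [add_mul]; omega)
            (by rw [min_eq_right (by omega)])
        · exact key (q + 1) 0 (by omega) (by rw [mul_add, add_mul]; omega)
            (by rw [mul_add]; simp)

/-- The staircase itself is good if its length is right: it is a line along which the gaps are
those of the gap set with `m₁` copies of `c₁` and `m₂` copies of `c₂`. -/
theorem good_staircase {T : Multiset ℤ} {m₁ m₂ : ℕ} (hT : 0 < Multiset.card T) (hm₁ : 0 < m₁)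
    (hm₂ : 0 < m₂) {k : ℕ} (hk : Multiset.card T + 2 ≤ k) :
    Good T m₁ m₂ {p | p.1 ≤ 2 * k * (Multiset.card T + (m₁ + m₂) + 1) * m₁ ∧
      m₂ * ((p.1 - 1) / m₁) ≤ p.2 ∧ p.2 ≤ m₂ * (p.1 / m₁)} := by
  intro c₁ c₂ h1 h2 u hu r hr
  have hQ : 0 < 2 * k * (Multiset.card T + (m₁ + m₂) + 1) :=
    Nat.mul_pos (by omega) (by omega)
  have hlen : 2 * k * (m₁ + m₂) * (Multiset.card T + (m₁ + m₂) + 1) =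
      2 * k * (Multiset.card T + (m₁ + m₂) + 1) * (m₁ + m₂) := by ring
  have hrect := tiled_rect_raised (t := Multiset.card T) (m := m₁ + m₂) (r := r)
    (l := 2 * k * (m₁ + m₂)) hr hT (by omega) (by simp [mul_assoc]) (by
      have : 2 * k * 1 ≤ 2 * k * (m₁ + m₂) := Nat.mul_le_mul_left _ (by omega)
      omega)
  rw [hlen] at hrect
  have := hrect.image (Q := IsWindow (T + Multiset.replicate m₁ (c₁ : ℤ) +
      Multiset.replicate m₂ (c₂ : ℤ)) 1 (fun p : ℕ × ℕ × ℕ => u p.1 + (c₁ * p.2.1 + c₂ * p.2.2)))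
      (fun p => (p.1, stairX m₁ m₂ p.2, stairY m₁ m₂ p.2)) ?_ ?_
  · convert this using 1
    ext ⟨x, y, z⟩
    simp only [Set.mem_ofPred_eq, Set.mem_image, Prod.exists, Prod.mk.injEq]
    rw [← mem_stair_iff hm₁ hm₂ hQ]
    constructor
    · rintro ⟨hx, i, hi, h3, h4⟩
      exact ⟨x, i, ⟨hx, by omega⟩, rfl, h3, h4⟩
    · rintro ⟨x', i, ⟨hx, hi⟩, rfl, h3, h4⟩
      exact ⟨hx, i, by omega, h3, h4⟩
  · rintro ⟨x, i⟩ - ⟨x', i'⟩ - heq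
    simp only [Prod.mk.injEq] at heq ⊢
    have := stairX_add_stairY m₁ m₂ i
    have := stairX_add_stairY m₁ m₂ i'
    exact ⟨heq.1, by omega⟩
  · intro B hB _
    rw [add_assoc T]
    exact IsPath.isWindow
      (V := Multiset.replicate m₁ (c₁ : ℤ) + Multiset.replicate m₂ (c₂ : ℤ))
      (by simpa using hB) le_rfl (by simp; omega) hu (isGapSeq_stair hm₂ h1 h2) _ _ fun p _ => rfl

/-- One large rectangle, whose sides are `1` modulo `2 (card T + m₁ + 1)` and
`2 (card T + m₂ + 1)`, is good. A staircase runs through its middle; the regions on both sides of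
it are cut into strips which can be filled from exact tiles in one of the two directions. -/
theorem exists_good_block {T : Multiset ℤ} {m₁ m₂ : ℕ} (hT : 0 < Multiset.card T) (hm₁ : 0 < m₁)
    (hm₂ : 0 < m₂) (H : ℕ) : ∃ k₁ k₂, H ≤ k₁ ∧ H ≤ k₂ ∧
      Good T m₁ m₂ {p | p.1 < 2 * (Multiset.card T + m₁ + 1) * k₁ + 1 ∧
        p.2 < 2 * (Multiset.card T + m₂ + 1) * k₂ + 1} := by
  obtain ⟨H₁, h₁⟩ := exists_good_stairs T hm₁ hm₂
  obtain ⟨H₂, h₂⟩ := exists_good_stairs T hm₂ hm₁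
  generalize ht : Multiset.card T = t at *
  obtain ⟨k, hk⟩ : ∃ k, H + H₁ + H₂ + t + 2 = k := ⟨_, rfl⟩
  obtain ⟨Q₁, hQ₁⟩ : ∃ Q₁, 2 * (t + m₂ + 1) * (t + (m₁ + m₂) + 1) * k = Q₁ := ⟨_, rfl⟩
  obtain ⟨Q₂, hQ₂⟩ : ∃ Q₂, 2 * (t + m₁ + 1) * (t + (m₁ + m₂) + 1) * k = Q₂ := ⟨_, rfl⟩
  obtain ⟨k', hk'⟩ : ∃ k', 2 * (t + m₁ + 1) * (t + m₂ + 1) * k = k' := ⟨_, rfl⟩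
  obtain ⟨Q, hQ⟩ : ∃ Q, 2 * k' * (t + (m₁ + m₂) + 1) = Q := ⟨_, rfl⟩
  have e1 : Q = 2 * Q₁ * (t + m₁ + 1) := by rw [← hQ, ← hk', ← hQ₁]; ring
  have e2 : Q = 2 * Q₂ * (t + m₂ + 1) := by rw [← hQ, ← hk', ← hQ₂]; ring
  have le1 : k ≤ Q₁ := by
    rw [← hQ₁]; exact Nat.le_mul_of_pos_left _ (by positivity)
  have le2 : k ≤ Q₂ := by
    rw [← hQ₂]; exact Nat.le_mul_of_pos_left _ (by positivity)
  have le3 : k ≤ k' := by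
    rw [← hk']; exact Nat.le_mul_of_pos_left _ (by positivity)
  have le4 : k ≤ Q := by
    rw [e1]
    exact le1.trans ((Nat.le_mul_of_pos_left _ two_pos).trans
      (Nat.le_mul_of_pos_right _ (by omega)))
  obtain ⟨Z₁, hZ₁⟩ : ∃ Z₁, Q * m₁ = Z₁ := ⟨_, rfl⟩
  obtain ⟨Z₂, hZ₂⟩ : ∃ Z₂, Q * m₂ = Z₂ := ⟨_, rfl⟩
  have hZpos : 0 < Z₁ := by rw [← hZ₁]; exact Nat.mul_pos (by omega) hm₁
  refine ⟨Q₁ * (m₁ + 2), Q₂ * (m₂ + 2), ?_, ?_, ?_⟩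
  · have := Nat.le_mul_of_pos_right Q₁ (show 0 < m₁ + 2 by omega); omega
  · have := Nat.le_mul_of_pos_right Q₂ (show 0 < m₂ + 2 by omega); omega
  have s1 : 2 * (t + m₁ + 1) * (Q₁ * (m₁ + 2)) = Q + Z₁ + Q := by
    rw [← hZ₁, e1]; ring
  have s2 : 2 * (t + m₂ + 1) * (Q₂ * (m₂ + 2)) = Q + Z₂ + Q := by
    rw [← hZ₂, e2]; ring
  rw [s1, s2]
  have hstair := good_staircase (T := T) (by omega) hm₁ hm₂ (k := k') (by omega)
  rw [ht, hQ, hZ₁] at hstair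
  -- Rectangles one of whose sides is `Q`.
  have hvert : ∀ b, H₁ ≤ b → Good T m₁ m₂ {p | p.1 < Q ∧ p.2 < b} := fun b hb => by
    have := (h₁ (2 * Q₁) b (by simp) hb).1
    rwa [← e1] at this
  have hhor : ∀ a, H₂ ≤ a → Good T m₁ m₂ {p | p.1 < a ∧ p.2 < Q} := fun a ha => by
    have := (h₂ (2 * Q₂) a (by simp) ha).1
    rw [← e2] at this
    refine this.swap.congr fun y z => ?_
    simp [and_comm]
  have eZ : Z₁ = 2 * (Q₁ * m₁) * (t + m₁ + 1) := by rw [← hZ₁, e1]; ring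
  have hlow := (h₁ (2 * (Q₁ * m₁)) Q (by simp) (by omega)).2.1
  rw [← eZ] at hlow
  have hdivlt : ∀ y < Z₁, m₂ * (y / m₁) + m₂ ≤ Z₂ := fun y hy => by
    have h3 : y / m₁ < Q := (Nat.div_lt_iff_lt_mul hm₁).2 (by omega)
    have := Nat.mul_le_mul_left m₂ (Nat.succ_le_of_lt h3)
    rw [Nat.mul_succ, mul_comm m₂ Q] at this; omega
  have hup := (h₁ (2 * (Q₁ * m₁)) (Q + 1) (by simp) (by omega)).2.2 (Q + Z₂ + Q + 1) (by
    rw [← eZ]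
    intro y hy
    have := hdivlt y hy
    omega)
  rw [← eZ] at hup
  have hZdiv : m₂ * (Z₁ / m₁) = Z₂ := by
    rw [← hZ₁, Nat.mul_div_cancel _ hm₁, ← hZ₂, mul_comm]
  refine Good.split (fun p => p.1 < Q + 1 ∧ p.2 < Q) ?_ ?_
  · refine (hhor (Q + 1) (by omega)).congr fun y z => ?_
    simp only [Set.mem_ofPred_eq]; omega
  refine Good.split (fun p => p.1 < Q) ?_ ?_
  · refine (hvert (Z₂ + Q + 1) (by omega)).translate 0 Q fun y z => ?_
    simp only [Set.mem_ofPred_eq]; omega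
  refine Good.split (fun p => p.1 < Q + Z₁ + 1 ∧ p.2 < Q + m₂ * ((p.1 - (Q + 1)) / m₁)) ?_ ?_
  · refine hlow.translate (Q + 1) 0 fun y z => ?_
    simp only [Set.mem_ofPred_eq]
    have := hdivlt (y - (Q + 1))
    have h0 : y ≤ Q → m₂ * ((y - (Q + 1)) / m₁) = 0 := fun h => by
      rw [Nat.sub_eq_zero_of_le (by omega), Nat.zero_div, mul_zero]
    generalize m₂ * ((y - (Q + 1)) / m₁) = w at *
    omega
  refine Good.split (fun p => Q + Z₁ < p.1 ∧ p.2 < Q + Z₂ + 1) ?_ ?_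
  · refine (hvert (Q + Z₂ + 1) (by omega)).translate (Q + Z₁ + 1) 0 fun y z => ?_
    simp only [Set.mem_ofPred_eq]
    generalize m₂ * ((y - (Q + 1)) / m₁) = w at *
    omega
  refine Good.split (fun p => Q + Z₁ ≤ p.1 ∧ Q + Z₂ + 1 ≤ p.2) ?_ ?_
  · refine (hhor (Q + 1) (by omega)).translate (Q + Z₁) (Q + Z₂ + 1) fun y z => ?_
    simp only [Set.mem_ofPred_eq]
    have h3 : y = Q + Z₁ → m₂ * ((y - (Q + 1)) / m₁) ≤ Z₂ := by
      rintro rfl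
      have := hdivlt (Q + Z₁ - (Q + 1)) (by omega); omega
    have h4 : y < Q + Z₁ + 1 → m₂ * ((y - (Q + 1)) / m₁) ≤ Z₂ := by
      intro h
      rcases Nat.lt_or_ge y (Q + Z₁) with h' | h'
      · have := hdivlt (y - (Q + 1)) (by omega); omega
      · exact h3 (by omega)
    generalize m₂ * ((y - (Q + 1)) / m₁) = w at *
    omega
  refine Good.split (fun p => p.1 < Q + Z₁ ∧ Q + 1 + m₂ * ((p.1 - Q) / m₁) ≤ p.2) ?_ ?_
  · refine hup.translate Q 0 fun y z => ?_
    simp only [Set.mem_ofPred_eq]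
    have h4 : m₂ * ((y - (Q + 1)) / m₁) ≤ m₂ * ((y - Q) / m₁) :=
      Nat.mul_le_mul_left _ (Nat.div_le_div_right (by omega))
    generalize m₂ * ((y - (Q + 1)) / m₁) = w at *
    generalize m₂ * ((y - Q) / m₁) = w' at *
    omega
  · refine hstair.translate Q Q fun y z => ?_
    simp only [Set.mem_ofPred_eq]
    rw [Nat.sub_sub]
    have h4 : m₂ * ((y - (Q + 1)) / m₁) ≤ m₂ * ((y - Q) / m₁) :=
      Nat.mul_le_mul_left _ (Nat.div_le_div_right (by omega))
    have h5 : y < Q + Z₁ → m₂ * ((y - Q) / m₁) + m₂ ≤ Z₂ := fun h => hdivlt _ (by omega)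
    have h6 : y = Q + Z₁ → m₂ * ((y - Q) / m₁) = Z₂ := by
      rintro rfl
      rw [Nat.add_sub_cancel_left, hZdiv]
    generalize m₂ * ((y - (Q + 1)) / m₁) = w at *
    generalize m₂ * ((y - Q) / m₁) = w' at *
    omega

/-- All sufficiently large rectangles are good. -/
theorem exists_good_rect {T : Multiset ℤ} {m₁ m₂ : ℕ} (hT : 0 < Multiset.card T) (hm₁ : 0 < m₁)
    (hm₂ : 0 < m₂) :
    ∃ H, ∀ a b, H ≤ a → H ≤ b → Good T m₁ m₂ {p | p.1 < a ∧ p.2 < b} := by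
  obtain ⟨H₁, h₁⟩ := exists_good_stairs T hm₁ hm₂
  obtain ⟨H₂, h₂⟩ := exists_good_stairs T hm₂ hm₁
  obtain ⟨k₁, k₂, hk₁, hk₂, hblock⟩ := exists_good_block hT hm₁ hm₂ (max H₁ H₂)
  obtain ⟨e₁, he₁⟩ : ∃ e, 2 * (Multiset.card T + m₁ + 1) = e := ⟨_, rfl⟩
  obtain ⟨e₂, he₂⟩ : ∃ e, 2 * (Multiset.card T + m₂ + 1) = e := ⟨_, rfl⟩
  rw [he₁, he₂] at hblock
  set G : ℕ → ℕ → Prop := fun a b => Good T m₁ m₂ {p | p.1 < a ∧ p.2 < b} with hG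
  have zl : ∀ b, G 0 b := fun b => Good.empty.congr fun y z => by simp
  have zr : ∀ a, G a 0 := fun a => Good.empty.congr fun y z => by simp
  have al : ∀ a a' b, G a b → G a' b → G (a + a') b := fun a a' b h h' => by
    refine Good.split (fun p => p.1 < a) (h.congr fun y z => ?_)
      (h'.translate a 0 fun y z => ?_) <;> simp only [Set.mem_ofPred_eq] <;> omega
  have ar : ∀ a b b', G a b → G a b' → G a (b + b') := fun a b b' h h' => by
    refine Good.split (fun p => p.2 < b) (h.congr fun y z => ?_)
      (h'.translate 0 b fun y z => ?_) <;> simp only [Set.mem_ofPred_eq] <;> omega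
  have mull : ∀ k a b, G a b → G (k * a) b := fun k a b h => by
    induction k with
    | zero => rw [zero_mul]; exact zl b
    | succ k ih => rw [add_mul, one_mul]; exact al _ _ _ ih h
  have mulr : ∀ k a b, G a b → G a (k * b) := fun k a b h => by
    induction k with
    | zero => rw [zero_mul]; exact zr a
    | succ k ih => rw [add_mul, one_mul]; exact ar _ _ _ ih h
  have gl : ∀ x b, max H₁ H₂ ≤ b → G (x * e₁) b := fun x b hb => mull x _ _ (by
    have := (h₁ 2 b even_two (by omega)).1
    rwa [he₁] at this)
  have gr : ∀ x a, max H₁ H₂ ≤ a → G a (x * e₂) := fun x a ha => mulr x _ _ (by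
    have := (h₂ 2 a even_two (by omega)).1
    rw [he₂] at this
    exact this.swap.congr fun y z => by simp [and_comm])
  -- A large side `h` is the sum of a multiple of `e` and of `h % e` copies of `e k + 1`.
  have hdecomp : ∀ e k h, 0 < e → e * (e * k + 1) ≤ h →
      ∃ x, h = x * e + h % e * (e * k + 1) := by
    intro e k h he hh
    have h1 := Nat.div_add_mod h e
    have h2 := Nat.mod_lt h he
    have h3 : e * k + 1 ≤ h / e := (Nat.le_div_iff_mul_le he).2 (by rw [mul_comm]; exact hh)
    have h4 : h % e * k ≤ h / e := by
      have := Nat.mul_le_mul_right k h2.le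
      omega
    obtain ⟨x, hx⟩ := Nat.exists_eq_add_of_le h4
    refine ⟨x, ?_⟩
    conv_lhs => rw [← h1, hx]
    ring
  refine ⟨e₁ * (e₁ * k₁ + 1) + e₂ * (e₂ * k₂ + 1) + max H₁ H₂, fun a b ha hb => ?_⟩
  obtain ⟨x, hx⟩ := hdecomp e₁ k₁ a (by omega) (by omega)
  obtain ⟨y, hy⟩ := hdecomp e₂ k₂ b (by omega) (by omega)
  have hle : ∀ e k, 0 < e → k ≤ e * k := fun e k he => Nat.le_mul_of_pos_left _ he
  change G a b
  rw [hx]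
  refine al _ _ _ (gl x b (by omega)) ?_
  rcases Nat.eq_zero_or_pos (a % e₁) with h0 | h0
  · rw [h0, zero_mul]; exact zl b
  · rw [hy]
    refine ar _ _ _ (gr y _ ?_) (mulr _ _ _ (mull _ _ _ hblock))
    have h5 := Nat.le_mul_of_pos_left (e₁ * k₁ + 1) h0
    have h6 := hle e₁ k₁ (by omega)
    omega

/-- Adding two further gap lengths, provided that the second one is large. -/
theorem SplitsTwice.exists_tilesLong_pair {T : Multiset ℤ} {c₁ m₁ m₂ : ℕ}
    (hT : 0 < Multiset.card T) (h : SplitsTwice (IsWindow T 1 id) c₁) (hm₁ : 0 < m₁)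
    (hm₂ : 0 < m₂) : ∃ B, ∀ c₂ : ℕ, B ≤ c₂ →
      TilesLong (IsWindow (T + Multiset.replicate m₁ (c₁ : ℤ) +
        Multiset.replicate m₂ (c₂ : ℤ)) 1 id) := by
  obtain ⟨H, hH⟩ := exists_good_rect hT hm₁ hm₂
  have hc₁ : 0 < c₁ := by obtain ⟨j, hj, -⟩ := h; omega
  have hinv : TranslationInvariant
      (fun A => ∃ h, H ≤ h ∧ IsColumn (IsWindow T 1 id) c₁ h A) := by
    rintro A a ⟨h, hh, hA⟩
    exact ⟨h, hh, (translationInvariant_isWindow T 1).isColumn c₁ h A a hA⟩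
  obtain ⟨B, hB⟩ :=
    (h.tilesLong (translationInvariant_isWindow T 1) H).exists_splitsTwice
  refine ⟨B, fun c₂ hc => ?_⟩
  have hc₂ : 0 < c₂ := by obtain ⟨j, hj, -⟩ := hB c₂ hc; omega
  obtain ⟨L₀, hL⟩ := (hB c₂ hc).tilesLong hinv H
  refine ⟨L₀, fun L hLL => (hL L hLL).bind ?_⟩
  rintro _ ⟨h₂, hh₂, _, ⟨h₁, hh₁, _, ⟨r, hr, u, hu, e, rfl, he⟩, hinj₁, rfl⟩, hinj₂, rfl⟩ -
  simp only [id] at he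
  have := (hH h₁ h₂ hh₁ hh₂ c₁ c₂ hc₁ hc₂ u hu r hr).image
    (Q := IsWindow (T + Multiset.replicate m₁ (c₁ : ℤ) + Multiset.replicate m₂ (c₂ : ℤ)) 1 id)
    (fun p => u p.1 + (c₁ * p.2.1 + c₂ * p.2.2)) ?_ fun A hA _ => hA.image _ 0 fun x _ => by simp
  · convert this using 1
    ext x
    simp only [Set.mem_image, Prod.exists, Set.mem_ofPred_eq, Set.mem_Iio]
    constructor
    · rintro ⟨_, z, ⟨⟨_, y, ⟨⟨i, hi, rfl⟩, hy⟩, rfl⟩, hz⟩, rfl⟩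
      exact ⟨i, y, z, ⟨hi, hy, hz⟩, by rw [he i hi]; ring⟩
    · rintro ⟨i, y, z, ⟨hi, hy, hz⟩, rfl⟩
      exact ⟨_, z, ⟨⟨_, y, ⟨⟨i, hi, rfl⟩, hy⟩, rfl⟩, hz⟩, by rw [he i hi]; ring⟩
  · rintro ⟨i, y, z⟩ ⟨hi, hy, hz⟩ ⟨i', y', z'⟩ ⟨hi', hy', hz'⟩ heq
    simp only at hi hi' hy hz hy' hz' heq
    have m1 := Set.mem_image_of_mem (fun p : ℤ × ℕ => p.1 + c₁ * p.2)
      (show (e i, y) ∈ {p : ℤ × ℕ | p.1 ∈ e '' Set.Iio (Multiset.card T + 1 + r) ∧ p.2 < h₁} from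
        ⟨⟨i, hi, rfl⟩, hy⟩)
    have m2 := Set.mem_image_of_mem (fun p : ℤ × ℕ => p.1 + c₁ * p.2)
      (show (e i', y') ∈ {p : ℤ × ℕ | p.1 ∈ e '' Set.Iio (Multiset.card T + 1 + r) ∧ p.2 < h₁} from
        ⟨⟨i', hi', rfl⟩, hy'⟩)
    have h3 := @hinj₂ (_, z) ⟨m1, hz⟩ (_, z') ⟨m2, hz'⟩ (by
      simp only [he i hi, he i' hi']; linarith)
    simp only [Prod.mk.injEq] at h3
    have h4 := @hinj₁ (e i, y) ⟨⟨i, hi, rfl⟩, hy⟩ (e i', y') ⟨⟨i', hi', rfl⟩, hy'⟩ h3.1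
    simp only [Prod.mk.injEq, he i hi, he i' hi'] at h4
    simp [hu.strictMono.injective h4.1, h4.2, h3.2]

/-! ### One or two gap lengths -/

theorem tiled_Ico_of_nat {T : Multiset ℤ} {s L : ℕ}
    (h : Tiled (IsWindow T 1 (fun n : ℕ => (n : ℤ))) {n | s ≤ n ∧ n < L}) :
    Tiled (IsWindow T 1 id) (Set.Ico (s : ℤ) L) := by
  have := h.image (Q := IsWindow T 1 id) (fun n : ℕ => (n : ℤ)) Nat.cast_injective.injOn
    fun A hA _ => hA.image _ 0 fun x _ => by simp
  convert this using 1
  ext x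
  simp only [Set.mem_Ico, Set.mem_image, Set.mem_ofPred_eq]
  constructor
  · rintro ⟨h1, h2⟩
    exact ⟨x.toNat, by omega, by omega⟩
  · rintro ⟨n, hn, rfl⟩
    omega

/-- The number `l` of nonnegative members of the class of `ρ` modulo `a` which are less than `L`. -/
theorem exists_lt_iff {a ρ L m : ℕ} (hρ : ρ < a) (hm : a * m ≤ L) :
    ∃ l, m ≤ l ∧ ∀ i, a * i + ρ < L ↔ i < l := by
  refine ⟨(L + a - 1 - ρ) / a, (Nat.le_div_iff_mul_le (by omega)).2 ?_, fun i => ?_⟩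
  · rw [mul_comm]; omega
  · have : i < (L + a - 1 - ρ) / a ↔ i + 1 ≤ (L + a - 1 - ρ) / a := Iff.rfl
    rw [this, Nat.le_div_iff_mul_le (by omega), add_mul, mul_comm i]
    omega

/-- Runs of `k + 1` and `k + 2` points of an arithmetic progression are windows for `k` equal
gaps. -/
theorem tiled_run {k a ρ : ℕ} (ha : 0 < a) (p q : ℕ) :
    Tiled (IsWindow (Multiset.replicate k (a : ℤ)) 1 (fun i : ℕ => ((a * i + ρ : ℕ) : ℤ)))
      {i | i < p * (k + 1) + q * (k + 2)} := by
  have step : ∀ l r, r ≤ 1 →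
      Tiled (IsWindow (Multiset.replicate k (a : ℤ)) 1 (fun i : ℕ => ((a * i + ρ : ℕ) : ℤ)))
        {i | i < l} →
      Tiled (IsWindow (Multiset.replicate k (a : ℤ)) 1 (fun i : ℕ => ((a * i + ρ : ℕ) : ℤ)))
        {i | i < l + (k + 1 + r)} := by
    intro l r hr h
    refine Tiled.split (fun i => i < l) ?_ (Tiled.of ⟨r, hr, _,
      isGapSeq_replicate k (a := (a : ℤ)) (by exact_mod_cast ha) (a * l + ρ), fun i => l + i,
      ?_, ?_⟩)
    · convert h using 1
      ext i; simp only [Set.mem_ofPred_eq]; omega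
    · ext i
      simp only [Set.mem_ofPred_eq, Multiset.card_replicate, Set.mem_image, Set.mem_Iio]
      exact ⟨fun h => ⟨i - l, by omega, by omega⟩, by rintro ⟨j, hj, rfl⟩; omega⟩
    · intro i _
      push_cast; ring
  have h0 : ∀ q, Tiled (IsWindow (Multiset.replicate k (a : ℤ)) 1
      (fun i : ℕ => ((a * i + ρ : ℕ) : ℤ))) {i | i < q * (k + 2)} := by
    intro q
    induction q with
    | zero =>
      simp only [zero_mul, Nat.not_lt_zero]
      exact Tiled.empty
    | succ q ih => rw [add_mul, one_mul]; exact step _ 1 le_rfl ih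
  induction p with
  | zero => simpa using h0 q
  | succ p ih =>
    rw [show (p + 1) * (k + 1) + q * (k + 2) = p * (k + 1) + q * (k + 2) + (k + 1 + 0) by ring]
    exact step _ 0 zero_le_one ih

theorem tiled_Ico_replicate {k a L : ℕ} (ha : 0 < a)
    (h : ∀ ρ < a, ∃ p q, ∀ i, a * i + ρ < L ↔ i < p * (k + 1) + q * (k + 2)) :
    Tiled (IsWindow (Multiset.replicate k (a : ℤ)) 1 id) (Set.Ico 0 (L : ℤ)) := by
  refine tiled_Ico_of_nat (s := 0) (Tiled.of_fibres (fun n => n % a) fun x _ => ?_)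
  obtain ⟨p, q, hpq⟩ := h (x % a) (Nat.mod_lt x ha)
  have := (tiled_run (k := k) (ρ := x % a) ha p q).image
    (Q := IsWindow (Multiset.replicate k (a : ℤ)) 1 (fun n : ℕ => (n : ℤ)))
    (fun i => a * i + x % a) (fun i _ j _ hij => by
      simpa [ha.ne'] using hij)
    fun A hA _ => hA.image _ 0 fun x _ => by simp
  convert this using 1
  ext n
  simp only [Set.mem_ofPred_eq, Set.mem_image, ← hpq]
  constructor
  · rintro ⟨⟨-, h1⟩, h2⟩
    have := Nat.div_add_mod n a
    rw [h2] at this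
    exact ⟨n / a, by omega, this⟩
  · rintro ⟨i, hi, rfl⟩
    exact ⟨⟨Nat.zero_le _, hi⟩, by rw [Nat.mul_add_mod, Nat.mod_mod]⟩

theorem tiled_Ico_replicate_of_le {k a L : ℕ} (ha : 0 < a) (hL : a * ((k + 1) * k) ≤ L) :
    Tiled (IsWindow (Multiset.replicate k (a : ℤ)) 1 id) (Set.Ico 0 (L : ℤ)) := by
  refine tiled_Ico_replicate ha fun ρ hρ => ?_
  obtain ⟨l, hl, h⟩ := exists_lt_iff hρ hL
  obtain ⟨p, q, rfl⟩ := exists_eq_mul_add_mul_succ (n := k + 1) (Nat.succ_pos k) hl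
  exact ⟨p, q, h⟩

/-- The cut can be made at `a (k + 1)`, where each residue class modulo `a` has exactly `k + 1`
members below the cut, and at `a (k + 1) + 1`, where one class has `k + 2`. -/
theorem splitsTwice_replicate {k a c : ℕ} (ha : 0 < a) (hc : a * (k + 2) ^ 2 ≤ c) :
    SplitsTwice (IsWindow (Multiset.replicate k (a : ℤ)) 1 id) c := by
  have e : a * (k + 2) ^ 2 = a * ((k + 1) * k) + a * (k + 1) + a * (k + 1) + a * (k + 2) := by ring
  have e1 : a ≤ a * (k + 2) := Nat.le_mul_of_pos_right _ (by omega)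
  have hlt : ∀ i, a * i < a * (k + 1) ↔ i < k + 1 := fun i => Nat.mul_lt_mul_left ha
  have hle : ∀ i, i ≤ k → a * i + a ≤ a * (k + 1) := fun i hi => by
    rw [← Nat.mul_succ]; exact Nat.mul_le_mul_left a (by omega)
  refine ⟨a * (k + 1), by omega, ?_, ?_, tiled_Ico_replicate_of_le ha (by omega),
    tiled_Ico_replicate_of_le ha (by omega)⟩
  · refine tiled_Ico_replicate ha fun ρ hρ => ⟨1, 0, fun i => ?_⟩
    have := hlt i
    have := hle i
    omega
  · refine tiled_Ico_replicate ha fun ρ hρ => ?_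
    rcases Nat.eq_zero_or_pos ρ with rfl | h0
    · refine ⟨0, 1, fun i => ?_⟩
      have h1 := hlt i
      have h2 : i = k + 1 → a * i = a * (k + 1) := by rintro rfl; rfl
      have h3 : k + 1 < i → a * (k + 1) + a ≤ a * i := fun h => by
        rw [← Nat.mul_succ]; exact Nat.mul_le_mul_left a h
      omega
    · refine ⟨1, 0, fun i => ?_⟩
      have := hlt i
      have := hle i
      have h2 : i = k + 1 → a * i = a * (k + 1) := by rintro rfl; rfl
      omega

theorem tilesLong_replicate {k a : ℕ} (ha : 0 < a) :
    TilesLong (IsWindow (Multiset.replicate k (a : ℤ)) 1 id) :=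
  ⟨a * ((k + 1) * k), fun _ hL => tiled_Ico_replicate_of_le ha hL⟩

/-- Two rows of cells, tiled by windows which pass from the first to the second row once. In the
first row the runs have lengths `k + 1 - ε`, then alternately `2` and `k` or `k + 1`. -/
theorem tiled_two_rows {k ε : ℕ} (hk : 0 < k) (hε : ε ≤ 1) (p q : ℕ) :
    Tiled (IsPath 1 k 1) {x | x.1 = 0 ∧ x.2 + ε < k + 1 + (p * (k + 2) + q * (k + 3)) ∨
      x.1 = 1 ∧ k ≤ x.2 + ε ∧ x.2 + ε < k + 1 + (p * (k + 2) + q * (k + 3)) + 1} := by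
  -- The end of the run number `i - 1`, with `q` long runs first.
  set β : ℕ → ℕ := fun i => if i = 0 then 0 else
    k + 1 - ε + ((i - 1) / 2 * (k + 2) + min ((i - 1) / 2) q + 2 * ((i - 1) % 2)) with hβ
  have hodd : ∀ j, β (2 * j + 1) = k + 1 - ε + (j * (k + 2) + min j q) := fun j => by
    have h1 : (2 * j + 1 - 1) / 2 = j := by omega
    have h2 : (2 * j + 1 - 1) % 2 = 0 := by omega
    simp only [hβ, h1, h2]
    rw [if_neg (by omega)]; omega
  have heven : ∀ j, β (2 * j + 2) = k + 1 - ε + (j * (k + 2) + min j q) + 2 := fun j => by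
    have h1 : (2 * j + 2 - 1) / 2 = j := by omega
    have h2 : (2 * j + 2 - 1) % 2 = 1 := by omega
    simp only [hβ, h1, h2]
    rw [if_neg (by omega)]; omega
  have h0 : β 0 = 0 := by simp [hβ]
  have h1 : β 1 = k + 1 - ε := by simpa using hodd 0
  have h2 : β 2 = k + 1 - ε + 2 := by simpa using heven 0
  have hmono : StrictMono β := by
    refine strictMono_nat_of_lt_succ fun i => ?_
    rcases Nat.even_or_odd' i with ⟨j, rfl | rfl⟩
    · rcases j with _ | j
      · rw [mul_zero, h0, zero_add, h1]; omega
      · have := heven j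
        have := hodd (j + 1)
        rw [show 2 * (j + 1) = 2 * j + 2 by ring] at *
        rw [add_mul] at this; omega
    · have := heven j
      have := hodd j
      rw [show 2 * j + 1 + 1 = 2 * j + 2 by ring]; omega
  have := tiled_strip (t := 1) (m := k) (ρ := 1) le_rfl hmono h0 (i₀ := 0)
    (i₁ := 2 * (p + q) + 1) fun i _ _ => by
      rcases Nat.even_or_odd' i with ⟨j, rfl | rfl⟩
      · rcases j with _ | j
        · change β 2 = β 0 + (1 + k + 1) ∨
            (1 = 1 ∧ β 2 = β 0 + (1 + k + 2) ∧ β 0 + 2 ≤ β 1 ∧ β 1 + 2 ≤ β 2)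
          omega
        · have e1 := heven j
          have e2 := hodd (j + 1)
          have e3 := heven (j + 1)
          rw [show 2 * (j + 1) = 2 * j + 2 by ring] at *
          rw [show 2 * j + 2 + 1 + 1 = 2 * j + 2 + 2 by ring]
          rw [add_mul] at e2 e3; omega
      · have e1 := heven j
        have e2 := hodd j
        have e3 := hodd (j + 1)
        rw [show 2 * j + 1 + 1 + 1 = 2 * (j + 1) + 1 by ring,
          show 2 * j + 1 + 1 = 2 * j + 2 by ring]
        rw [add_mul] at e3; omega
  convert this using 1
  have e1 := hodd (p + q)
  have e2 := heven (p + q)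
  have e3 : (p + q) * (k + 2) + q = p * (k + 2) + q * (k + 3) := by ring
  ext ⟨x, z⟩
  simp only [Set.mem_ofPred_eq]
  constructor
  · rintro (⟨rfl, h⟩ | ⟨rfl, h⟩)
    · change 0 < 2 ∧ β 0 ≤ 0 + z ∧ 0 + z < β (2 * (p + q) + 1)
      omega
    · change 1 < 2 ∧ β 1 ≤ 1 + z ∧ 1 + z < β (2 * (p + q) + 2)
      omega
  · rintro ⟨hx, h⟩
    have : x = 0 ∨ x = 1 := by omega
    rcases this with rfl | rfl
    · change β 0 ≤ 0 + z ∧ 0 + z < β (2 * (p + q) + 1) at h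
      omega
    · change β 1 ≤ 1 + z ∧ 1 + z < β (2 * (p + q) + 2) at h
      omega

/-- For gaps `a ^ k, b`, put the points below `b + a k` into the first row and the others, moved by
`-b`, into the second one; each residue class modulo `a` then is an instance of `tiled_two_rows`. -/
theorem tiled_Ico_pair {k a b ε : ℕ} (ha : 0 < a) (hk : 0 < k) (hb : a * (k + 2) ^ 2 ≤ b)
    (hε : ε ≤ 1) :
    Tiled (IsWindow (Multiset.replicate 1 (b : ℤ) + Multiset.replicate k (a : ℤ)) 1 id)
      (Set.Ico (ε : ℤ) ((2 * b + a * (k + 1) : ℕ) : ℤ)) := by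
  have hsq : a * (k + 2) ^ 2 = a * (k + 1 + (k + 2) * (k + 1)) + a := by ring
  have hak : a * (k + 1) = a * k + a := by ring
  have hb0 : 0 < b := by omega
  refine tiled_Ico_of_nat (Tiled.of_fibres
    (fun n => if n < b + a * k then n % a else (n - b) % a) fun x _ => ?_)
  obtain ⟨ρ, hρ⟩ : ∃ ρ, (if x < b + a * k then x % a else (x - b) % a) = ρ := ⟨_, rfl⟩
  rw [hρ]
  have hρa : ρ < a := by rw [← hρ]; split_ifs <;> exact Nat.mod_lt _ ha
  obtain ⟨l, hl, hlt⟩ := exists_lt_iff (L := b + a * k) (m := k + 1 + (k + 2) * (k + 1)) hρa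
    (by omega)
  obtain ⟨l, rfl⟩ := Nat.exists_eq_add_of_le (show k + 1 ≤ l by omega)
  obtain ⟨p, q, rfl⟩ : ∃ p q, l = p * (k + 2) + q * (k + 3) :=
    exists_eq_mul_add_mul_succ (n := k + 2) (by omega)
      (by rw [show k + 2 - 1 = k + 1 from rfl]; omega)
  -- Only the class of the multiples of `a` loses its first point if `ε = 1`.
  obtain ⟨δ, hδ⟩ : ∃ δ, (if ρ = 0 then ε else 0) = δ := ⟨_, rfl⟩
  have hδ1 : δ ≤ 1 := by rw [← hδ]; split_ifs <;> omega
  have hδε : ∀ i, ε ≤ a * i + ρ ↔ δ ≤ i := fun i => by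
    rcases Nat.eq_zero_or_pos i with rfl | hi
    · rw [← hδ]; split_ifs <;> omega
    · have := Nat.mul_pos ha hi
      omega
  have hkle : ∀ i, a * k ≤ a * i + ρ ↔ k ≤ i := fun i => by
    constructor
    · intro h
      by_contra! hlt
      have := Nat.mul_le_mul_left a (Nat.succ_le_of_lt hlt)
      rw [Nat.mul_succ] at this; omega
    · intro h
      have := Nat.mul_le_mul_left a h; omega
  have hrow := tiled_two_rows hk hδ1 p q
  have himg := hrow.image
    (Q := IsWindow (Multiset.replicate 1 (b : ℤ) + Multiset.replicate k (a : ℤ)) 1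
      (fun n : ℕ => (n : ℤ)))
    (fun x => b * x.1 + (a * (x.2 + δ) + ρ)) ?_ ?_
  · convert himg using 1
    ext n
    simp only [Set.mem_ofPred_eq, Set.mem_image, Prod.exists]
    constructor
    · rintro ⟨⟨hn1, hn2⟩, hn3⟩
      split_ifs at hn3 with hn
      · have h1 := Nat.div_add_mod n a
        rw [hn3] at h1
        have h2 := (hδε (n / a)).1 (by omega)
        have h3 := (hlt (n / a)).1 (by omega)
        refine ⟨0, n / a - δ, Or.inl ⟨rfl, by omega⟩, ?_⟩
        rw [Nat.sub_add_cancel h2]; omega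
      · have h1 := Nat.div_add_mod (n - b) a
        rw [hn3] at h1
        have h2 := (hkle ((n - b) / a)).1 (by omega)
        have h3 := (hlt ((n - b) / a - 1)).1 (by
          rw [Nat.mul_sub, mul_one]; omega)
        refine ⟨1, (n - b) / a - δ, Or.inr ⟨rfl, by omega, by omega⟩, ?_⟩
        rw [Nat.sub_add_cancel (by omega)]; omega
    · rintro ⟨y, z, ⟨rfl, h⟩ | ⟨rfl, h1, h2⟩, rfl⟩
      · have h3 := (hlt (z + δ)).2 h
        have h4 := (hδε (z + δ)).2 (by omega)
        rw [mul_zero, zero_add]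
        refine ⟨⟨h4, by omega⟩, ?_⟩
        rw [if_pos h3, Nat.mul_add_mod, Nat.mod_eq_of_lt hρa]
      · have h3 := (hlt (z + δ - 1)).2 (by omega)
        have h4 := (hkle (z + δ)).2 h1
        have h5 : a * (z + δ - 1) + a = a * (z + δ) := by
          rw [← Nat.mul_succ, Nat.succ_eq_add_one, Nat.sub_add_cancel (by omega)]
        rw [mul_one]
        refine ⟨⟨by omega, by omega⟩, ?_⟩
        rw [if_neg (by omega), Nat.add_sub_cancel_left, Nat.mul_add_mod, Nat.mod_eq_of_lt hρa]
  · have hinj : ∀ z z', a * (z + δ) = a * (z' + δ) → z = z' := fun z z' h => by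
      have := Nat.eq_of_mul_eq_mul_left ha h; omega
    rintro ⟨y, z⟩ hyz ⟨y', z'⟩ hyz' heq
    simp only [Set.mem_ofPred_eq] at hyz hyz' heq
    have hlt1 := hlt (z + δ)
    have hlt2 := hlt (z' + δ)
    have hle1 := hkle (z + δ)
    have hle2 := hkle (z' + δ)
    have := hinj z z'
    rw [Prod.mk.injEq]
    rcases hyz with ⟨rfl, h⟩ | ⟨rfl, h⟩ <;> rcases hyz' with ⟨rfl, h'⟩ | ⟨rfl, h'⟩
    · exact ⟨rfl, this (by omega)⟩
    · omega
    · omega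
    · exact ⟨rfl, this (by omega)⟩
  · intro B hB _
    refine IsPath.isWindow (T := Multiset.replicate 1 (b : ℤ))
      (V := Multiset.replicate k (a : ℤ)) (by simpa using hB) le_rfl (by simpa)
      (isGapSeq_replicate 1 (by exact_mod_cast hb0) 0)
      (isGapSeq_replicate k (by exact_mod_cast ha) (a * δ + ρ)) _ _ fun x _ => ?_
    push_cast; ring

/-- The intervals `[0, M)` and `[1, M)` with `M = 2 b + a (k + 1)` have coprime lengths. -/
theorem tilesLong_pair {k a b : ℕ} (ha : 0 < a) (hk : 0 < k) (hb : a * (k + 2) ^ 2 ≤ b) :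
    TilesLong (IsWindow (Multiset.replicate k (a : ℤ) + Multiset.replicate 1 (b : ℤ)) 1 id) := by
  have h0 := tiled_Ico_pair ha hk hb zero_le_one
  have h1 := (tiled_Ico_pair ha hk hb le_rfl).translate (translationInvariant_isWindow _ _) (-1)
  have hpos : a * 1 ≤ a * (k + 1) := Nat.mul_le_mul_left a (by omega)
  have hsq : a * 1 ≤ a * (k + 2) ^ 2 := Nat.mul_le_mul_left a (Nat.one_le_pow _ _ (by omega))
  obtain ⟨M, hM⟩ := Nat.exists_eq_add_of_le' (show 1 ≤ 2 * b + a * (k + 1) by omega)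
  rw [add_comm (Multiset.replicate k _)]
  rw [hM] at h0 h1
  refine tilesLong_of_succ (translationInvariant_isWindow _ _) (n := M) (by omega) ?_ ?_
  · convert h1 using 2 <;> simp
  · simpa using h0

/-! ### All gap lengths -/

theorem gapMultiset_succ (n : ℕ) (d k : ℕ → ℕ) :
    gapMultiset (n + 1) d k =
      gapMultiset n d k + Multiset.replicate (k (n + 1)) (d (n + 1) : ℤ) := by
  rw [gapMultiset, Finset.sum_Icc_succ_top (by omega), gapMultiset]

theorem gapMultiset_one (d k : ℕ → ℕ) :
    gapMultiset 1 d k = Multiset.replicate (k 1) (d 1 : ℤ) := by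
  simp [gapMultiset]

theorem gapMultiset_congr {n : ℕ} {d d' k k' : ℕ → ℕ} (hd : ∀ i ∈ Finset.Icc 1 n, d i = d' i)
    (hk : ∀ i ∈ Finset.Icc 1 n, k i = k' i) : gapMultiset n d k = gapMultiset n d' k' :=
  Finset.sum_congr rfl fun i hi => by rw [hd i hi, hk i hi]

theorem card_gapMultiset_pos {n : ℕ} {d k : ℕ → ℕ} (hn : 1 ≤ n) (hk : 0 < k 1) :
    0 < Multiset.card (gapMultiset n d k) := by
  induction n, hn using Nat.le_induction with
  | base => rw [gapMultiset_one]; simpa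
  | succ n _ ih => rw [gapMultiset_succ, Multiset.card_add]; omega

open Classical in
/-- A bound from which on the property `p` holds, if there is one. -/
noncomputable def eventualBound (p : ℕ → Prop) : ℕ :=
  if h : ∃ B, ∀ c, B ≤ c → p c then h.choose else 0

theorem of_eventualBound_le {p : ℕ → Prop} (h : ∃ B, ∀ c, B ≤ c → p c) {c : ℕ}
    (hc : eventualBound p ≤ c) : p c := by
  rw [eventualBound, dif_pos h] at hc
  exact h.choose_spec c hc

open Classical in
/-- Extension by zero of a function on a finite set of indices. -/
noncomputable def extendByZero {s : Finset ℕ} (f : s → ℕ) (i : ℕ) : ℕ :=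
  if h : i ∈ s then f ⟨i, h⟩ else 0

theorem extendByZero_of_mem {s : Finset ℕ} (f : ℕ → ℕ) {i : ℕ} (hi : i ∈ s) :
    extendByZero (fun j : s => f j) i = f i := by
  rw [extendByZero, dif_pos hi]

/-- How large `d i` has to be for given `d j` with `j < i` and `k j` with `j ≤ i`: the intervals of
length `d i` are to be decomposed by means of the first `i - 1` gap lengths, and the gap lengths
number `i - 1` and `i` can be added to the first `i - 2` ones. -/
noncomputable def gapBound (i : ℕ) (d k : ℕ → ℕ) : ℕ :=
  max (eventualBound fun c => SplitsTwice (IsWindow (gapMultiset (i - 1) d k) 1 id) c ∧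
      Tiled (IsWindow (gapMultiset (i - 1) d k) 1 id) (Set.Ico 0 (c : ℤ)))
    (eventualBound fun c => TilesLong (IsWindow (gapMultiset (i - 2) d k +
      Multiset.replicate (k (i - 1)) (d (i - 1) : ℤ) + Multiset.replicate (k i) (c : ℤ)) 1 id))

theorem gapBound_congr {i : ℕ} {d d' k k' : ℕ → ℕ} (hi : 3 ≤ i)
    (hd : ∀ j ∈ Finset.Ico 1 i, d j = d' j) (hk : ∀ j ∈ Finset.Icc 1 i, k j = k' j) :
    gapBound i d k = gapBound i d' k' := by
  have h1 : gapMultiset (i - 1) d k = gapMultiset (i - 1) d' k' :=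
    gapMultiset_congr (fun j hj => hd j (by simp only [Finset.mem_Icc, Finset.mem_Ico] at *; omega))
      fun j hj => hk j (by simp only [Finset.mem_Icc] at *; omega)
  have h2 : gapMultiset (i - 2) d k = gapMultiset (i - 2) d' k' :=
    gapMultiset_congr (fun j hj => hd j (by simp only [Finset.mem_Icc, Finset.mem_Ico] at *; omega))
      fun j hj => hk j (by simp only [Finset.mem_Icc] at *; omega)
  have h3 : d (i - 1) = d' (i - 1) := hd _ (by simp only [Finset.mem_Ico]; omega)
  have h4 : k (i - 1) = k' (i - 1) := hk _ (by simp only [Finset.mem_Icc]; omega)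
  have h5 : k i = k' i := hk _ (by simp only [Finset.mem_Icc]; omega)
  simp only [gapBound, h1, h2, h3, h4, h5]

theorem TilesLong.of_eventualBound_le {P : Set ℤ → Prop} (h : TilesLong P) {c : ℕ}
    (hc : eventualBound (fun c => SplitsTwice P c ∧ Tiled P (Set.Ico 0 (c : ℤ))) ≤ c) :
    SplitsTwice P c ∧ Tiled P (Set.Ico 0 (c : ℤ)) := by
  obtain ⟨B, hB⟩ := h.exists_splitsTwice
  obtain ⟨L, hL⟩ := h
  exact _root_.of_eventualBound_le ⟨max B L, fun c hc => ⟨hB c (by omega), hL c (by omega)⟩⟩ hc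

/-- Every initial part of the gap lengths decomposes all long intervals. -/
theorem tilesLong_gapMultiset {n : ℕ} {d k : ℕ → ℕ} (hd : ∀ i ∈ Finset.Icc 1 n, 0 < d i)
    (hk : ∀ i ∈ Finset.Icc 1 n, 0 < k i) (h2 : d 1 * (k 1 + k 2 + 1) ^ 2 ≤ d 2)
    (hg : ∀ i ∈ Finset.Icc 3 n, gapBound i d k ≤ d i) :
    ∀ j, 1 ≤ j → j ≤ n → TilesLong (IsWindow (gapMultiset j d k) 1 id) := by
  simp only [Finset.mem_Icc, and_imp] at hd hk hg
  have hsplit : 2 ≤ n → SplitsTwice (IsWindow (gapMultiset 1 d k) 1 id) (d 2) := fun hn => by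
    rw [gapMultiset_one]
    refine splitsTwice_replicate (hd 1 le_rfl (by omega)) (le_trans ?_ h2)
    have := hk 2 (by omega) hn
    exact Nat.mul_le_mul_left _ (Nat.pow_le_pow_left (by omega) 2)
  intro j
  induction j using Nat.strong_induction_on with
  | _ j ih =>
    intro hj hjn
    have hd1 := hd 1 le_rfl (by omega)
    have hk1 := hk 1 le_rfl (by omega)
    obtain rfl | rfl | hj3 : j = 1 ∨ j = 2 ∨ 3 ≤ j := by omega
    · rw [gapMultiset_one]
      exact tilesLong_replicate hd1
    · have hk2 := hk 2 (by omega) hjn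
      rw [gapMultiset_succ]
      rcases Nat.lt_or_ge (k 2) 2 with h | h
      · have : k 2 = 1 := by omega
        rw [this] at h2
        simp only [Nat.reduceAdd, this, gapMultiset_one]
        exact tilesLong_pair hd1 hk1 (by convert h2 using 3)
      · exact (hsplit hjn).tilesLong_isWindow (card_gapMultiset_pos le_rfl hk1) h
    · obtain ⟨i, rfl⟩ := Nat.exists_eq_add_of_le' (show 2 ≤ j by omega)
      have hs : SplitsTwice (IsWindow (gapMultiset i d k) 1 id) (d (i + 1)) := by
        obtain rfl | hi2 : i = 1 ∨ 2 ≤ i := by omega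
        · exact hsplit (by omega)
        · exact ((ih i (by omega) (by omega) (by omega)).of_eventualBound_le
            ((le_max_left _ _).trans (hg (i + 1) (by omega) (by omega)))).1
      have hpair := hs.exists_tilesLong_pair (m₁ := k (i + 1)) (m₂ := k (i + 2))
        (card_gapMultiset_pos (by omega) hk1) (hk _ (by omega) (by omega))
        (hk _ (by omega) (by omega))
      have := of_eventualBound_le hpair
        ((le_max_right _ _).trans (hg (i + 2) (by omega) (by omega)))
      rwa [← gapMultiset_succ, ← gapMultiset_succ] at this

theorem theorem1 :
    ∃ g : (i : ℕ) → (Finset.Ico 1 i → ℕ) → (Finset.Icc 1 i → ℕ) → ℕ,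
      ∀ (s p : ℕ) (d k : ℕ → ℕ), 2 ≤ s → 1 ≤ p →
        (∀ i ∈ Finset.Icc 1 (s + p), 0 < d i) →
        (∀ i ∈ Finset.Icc 1 (s + p), 0 < k i) →
        (∑ i ∈ Finset.Icc 3 s, k i) + 1 ≤ k 1 →
        (∑ i ∈ Finset.Icc (s + 1) (s + p - 1), k i) + 1 ≤ k (s + p) →
        d 1 * (k 1 + k 2 + 1) ^ 2 ≤ d 2 →
        (∀ i ∈ Finset.Icc 3 (s + p), g i (fun j => d j) (fun j => k j) ≤ d i) →
        GapSetTilesInterval (gapMultiset (s + p) d k) := by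
  refine ⟨fun i d k => gapBound i (extendByZero d) (extendByZero k), ?_⟩
  intro s p d k hs hp hd hk _ _ h2 hg
  have hg' : ∀ i ∈ Finset.Icc 3 (s + p), gapBound i d k ≤ d i := fun i hi => by
    refine le_trans (le_of_eq ?_) (hg i hi)
    exact gapBound_congr (Finset.mem_Icc.1 hi).1 (fun j hj => (extendByZero_of_mem d hj).symm)
      fun j hj => (extendByZero_of_mem k hj).symm
  obtain ⟨n, hn⟩ := Nat.exists_eq_add_of_le' (show 1 ≤ s + p by omega)
  have hn2 : 2 ≤ n := by omega
  rw [hn] at hd hk hg' ⊢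
  have hmem : n + 1 ∈ Finset.Icc 1 (n + 1) := Finset.mem_Icc.2 ⟨by omega, le_rfl⟩
  have hlong := tilesLong_gapMultiset hd hk h2 hg' n (by omega) (by omega)
  have htiled := (hlong.of_eventualBound_le ((le_max_left _ _).trans
    (hg' (n + 1) (Finset.mem_Icc.2 ⟨by omega, le_rfl⟩)))).2
  obtain ⟨L, hL, F, hF, hdisj, hU⟩ := tiled_exact (hk _ hmem) (hd _ hmem) htiled
  rw [gapMultiset_succ]
  refine ⟨0, (L : ℤ) - 1, by omega, F, fun A hA => (hF A hA).isTile, hdisj, ?_⟩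
  rw [hU]
  ext x
  simp only [Set.mem_Ico, Set.mem_Icc]; omega
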